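/- **Model.** Time is divided into micro-intervals of length $\mu = 1/M$, where $M \ge 1$ is an integer. For an integer time $T \ge 1$, an encoder is a function $E:\{0,1\}^k \to \{0,1\}^{MT}$ and a decoder is a function $D:(\mathbb{Z}^{\ge 0})^{MT} \to \{0,1\}^k$. When the codeword is $X = E(m)$, the noise is $\xi:[MT]\to\{0,1\}$ and the delay is $\Delta:[MT]\to\mathbb{Z}^{\ge 0}$, the receiver gets $$Y_i = \sum_{j\,:\, j+\Delta(j)=i} (X_j\oplus\xi(j)), \qquad 1 \le i \le MT .$$ Adversarial noise $N(\varepsilon)^A$ is any $\xi$ with at most $\varepsilon MT$ ones; probabilistic noise $N(\varepsilon)^P$ has $\xi(j)$ independent with $\Pr[\xi(j)=1]=\varepsilon$. An adversarial delay $D^A$ is any $\Delta$ with $\Delta(j)\le M$ for all $j$; a probabilistic delay $D^P$ has $\Delta(j)$ independent with the (discretized exponential, memoryless) law $\Pr[\Delta(j)=d]=\frac1M\left(1-\frac1M\right)^d$, $d \ge 0$. In the channel $A|B$ the component $A$ acts first and then $B$ acts with knowledge of what $A$ did; every adversary knows the code and the transmitted codeword. The decoding error probability $\Pr_{\rm dec}(E,D)$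 is the supremum, over the strategies of the adversary, of $\Pr[D(Y)\ne m]$ for $m$ uniform on $\{0,1\}^k$. A $\mu$-discretized system is a sequence $(k_T,E_T,D_T)_T$; its rate is $\limsup_{T\to\infty} k_T/T$, it is reliable if $\Pr_{\rm dec}(E_T,D_T)\to 0$ as $T\to\infty$, and the capacity of a channel is the supremum of the rates of all reliable $\mu$-discretized systems, over all $\mu=1/M$. **Theorem (Finite Capacity Case).** The channels $D^A|N(\varepsilon)^A$ and $D^P|N(\varepsilon)^A$ for every $\varepsilon>0$, and the channels $D^A|N(\varepsilon)^P$ and $N(\varepsilon)^P|D^A$ for every $0<\varepsilon<1$, have finite capacity. That is, for each of these channel types and each such $\varepsilon$ there is $C<\infty$ such that the capacity is at most $C$, and for every $R>C$ there is $\gamma>0$ such that for every $M\ge1$ (with $\mu=1/M$), every $T\ge1$, every $k\ge RT$ and every encoder $E:\{0,1\}^k\to\{0,1\}^{MT}$ and decoder $D:(\mathbb{Z}^{\ge0})^{MT}\to\{0,1\}^k$, one has $\Pr_{\rm dec}(E,D)\ge\gamma$. -/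

import Mathlib

open MeasureTheory ProbabilityTheory Filter
open scoped ENNReal NNReal

noncomputable section

namespace DelayChannel

/-- Bit sequences of length `n`. -/
abbrev Word (n : ℕ) := Fin n → Bool

/-- Sequences of non-negative integers: the received signals, and also the delay functions. -/
abbrev Counts (n : ℕ) := Fin n → ℕ

/-- The received sequence `Y_i = ∑_{j + Δ(j) = i} (X_j ⊕ ξ(j))` for codeword `X`, noise `ξ` and
delay `Δ`. Symbols with `j + Δ(j)` beyond the last instant are not received. -/
def received {n : ℕ} (X ξ : Word n) (Δ : Counts n) : Counts n := fun i =>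
  ∑ j ∈ Finset.univ.filter (fun j : Fin n => (j : ℕ) + Δ j = i), (xor (X j) (ξ j)).toNat

/-- The number of flipped positions of a noise function. -/
def flips {n : ℕ} (ξ : Word n) : ℕ := (Finset.univ.filter fun j => ξ j = true).card

/-- The law of probabilistic noise: every bit is flipped independently with probability `ε`. -/
def noiseLaw (ε : unitInterval) (n : ℕ) : Measure (Word n) :=
  Measure.pi fun _ => bernoulliMeasure true false ε

/-- The probability `1 / M` with which a waiting symbol departs in a given micro-interval. -/
def departProb (M : ℕ+) : unitInterval :=
  ⟨1 / (M : ℝ), by positivity, by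
    have h : (1 : ℝ) ≤ (M : ℝ) := by exact_mod_cast M.pos
    exact div_le_one_of_le₀ h (by positivity)⟩

/-- The law of probabilistic delays: independent memoryless delays, equal to `d` micro-intervals
with probability `(1 - 1 / M) ^ d * (1 / M)`, which is the exponential delay of mean one unit of
time on the grid of micro-intervals of length `1 / M`. -/
def delayLaw (M : ℕ+) (n : ℕ) : Measure (Counts n) :=
  Measure.pi fun _ => geometricMeasure (departProb M)

/-- A channel that is partly probabilistic and partly adversarial. For `M` micro-intervals per
unit of time and `n` transmitted bits it is given by the set of its possible behaviours, one for
each strategy of the adversary; a behaviour assigns to every codeword the law of the received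
sequence. -/
abbrev Channel := (M : ℕ+) → (n : ℕ) → Set (Word n → Measure (Counts n))

/-- `D^A | N(ε)^A`: an adversary delays every symbol by at most `M` micro-intervals, and then an
adversary who sees the delays flips at most an `ε` fraction of the bits. -/
def advDelayAdvNoise (ε : ℝ) : Channel := fun M n =>
  {W | ∃ (delay : Word n → Counts n) (noise : Word n → Counts n → Word n),
    (∀ X j, delay X j ≤ M) ∧
    (∀ X Δ, (flips (noise X Δ) : ℝ) ≤ ε * n) ∧
    ∀ X, W X = Measure.dirac (received X (noise X (delay X)) (delay X))}

/-- `D^P | N(ε)^A`: the delays are random, and then an adversary who sees the delays flips at most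
an `ε` fraction of the bits. -/
def randDelayAdvNoise (ε : ℝ) : Channel := fun M n =>
  {W | ∃ noise : Word n → Counts n → Word n,
    (∀ X Δ, (flips (noise X Δ) : ℝ) ≤ ε * n) ∧
    ∀ X, W X = (delayLaw M n).map fun Δ => received X (noise X Δ) Δ}

/-- `D^A | N(ε)^P`: an adversary delays every symbol by at most `M` micro-intervals, without
knowing the noise, and then the noise is random. -/
def advDelayRandNoise (ε : unitInterval) : Channel := fun M n =>
  {W | ∃ delay : Word n → Counts n,
    (∀ X j, delay X j ≤ M) ∧
    ∀ X, W X = (noiseLaw ε n).map fun ξ => received X ξ (delay X)}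

/-- `N(ε)^P | D^A`: the noise is random, and then an adversary who sees the noise delays every
symbol by at most `M` micro-intervals. -/
def randNoiseAdvDelay (ε : unitInterval) : Channel := fun M n =>
  {W | ∃ delay : Word n → Word n → Counts n,
    (∀ X ξ j, delay X ξ j ≤ M) ∧
    ∀ X, W X = (noiseLaw ε n).map fun ξ => received X ξ (delay X ξ)}

/-- The decoding error probability: the message is uniform on `{0,1}^k`, and the adversary of the
channel plays so as to maximize the probability of error. -/
def decodingError (𝒞 : Channel) (M : ℕ+) {n k : ℕ} (E : Word k → Word n) (D : Counts n → Word k) :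
    ℝ≥0∞ :=
  ⨆ W ∈ 𝒞 M n, (∑ m : Word k, W (E m) {y | D y ≠ m}) / 2 ^ k

/-- A `1 / M`-discretized communication system: for every time `T`, the number of message bits,
an encoder and a decoder. -/
structure System (M : ℕ+) where
  /-- the number of bits transmitted in time `T` -/
  bits : ℕ → ℕ
  /-- the encoders -/
  enc : (T : ℕ) → Word (bits T) → Word (M * T)
  /-- the decoders -/
  dec : (T : ℕ) → Counts (M * T) → Word (bits T)

/-- The asymptotic rate, in bits per unit of time. -/
def System.rate {M : ℕ+} (S : System M) : ℝ≥0∞ :=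
  limsup (fun T : ℕ => (S.bits T : ℝ≥0∞) / (T : ℝ≥0∞)) atTop

/-- The error probability of the system tends to zero. -/
def System.Reliable {M : ℕ+} (S : System M) (𝒞 : Channel) : Prop :=
  Tendsto (fun T : ℕ => decodingError 𝒞 M (S.enc T) (S.dec T)) atTop (nhds 0)

/-- The capacity: the supremum of the rates of all reliable systems, over all discretizations. -/
def capacity (𝒞 : Channel) : ℝ≥0∞ :=
  ⨆ (M : ℕ+) (S : System M) (_ : S.Reliable 𝒞), S.rate

/-- There is a finite bound `C` on the capacity such that every encoder and decoder of a rate `R`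
above `C`, with any discretization, have a decoding error probability bounded below by a positive
`γ`, which depends only on the channel and on `R`. -/
def FiniteCapacity (𝒞 : Channel) : Prop :=
  ∃ C : ℝ≥0, capacity 𝒞 ≤ C ∧
    ∀ R : ℝ≥0, C < R → ∃ γ : ℝ≥0, 0 < γ ∧
      ∀ (M : ℕ+) (T k : ℕ), 0 < T → (R : ℝ) * T ≤ k →
        ∀ (E : Word k → Word (M * T)) (D : Counts (M * T) → Word k),
          (γ : ℝ≥0∞) ≤ decodingError 𝒞 M E D

end DelayChannel

end

/-! The adversary defeats refinement of the time grid by quantizing what is received. It suffices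
that, for a suitable strategy, the output laws of all codewords are dominated, up to mass 1/4, by
one measure `Q` of mass at most `2 ^ (K * T)`, with `K` independent of the discretization. Decoding
regions are disjoint, so the `2 ^ k` messages share the mass of `Q`, and for `k > K T` the success
probabilities sum to at most `2 ^ k / 2 + 2 ^ k / 4` (`quarter_le_error`,
`FiniteCapacity.of_dominated`).

Adversarial delay and noise: symbols wait for the end of their unit of time, and ones are erased
until each total is a multiple of `q`, about `ε M`. Boundedly many totals per unit remain, and `Q`
is a product of sums of point masses.

Random noise: totals now fluctuate, so their means are quantized instead. With `L = M / 2` and `p =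
min ε (1 - ε)`, symbols are held back so that each batch has mean within 1 of a multiple of `p L`. A
local limit bound with quadratic decay (`measureReal_arrivals_mul_sq_le`) puts the law of a batch
below a Lorentzian of height `O(1 / √L)` and width `√L`, centred at one of boundedly many points.
Its mass is bounded whatever `L` is, and independence of the batches makes `Q` a product.

Random delays: by memorylessness, the position at which a symbol leaves a later interval of length
`B` than its own has a fixed law (`map_relocate`). Once the ones leaving in their own interval are
erased, the output law depends only on how many ones leave in each interval. Rounding these numbers
to multiples of `q`, about `ε B / 4`, leaves `2 ^ O(T)` profiles, and `Q` is the sum of their laws.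
The slack 1/4 pays for the delays that would exceed the noise budget. -/

noncomputable section

namespace DelayChannel

/-! ### The domination criterion -/

/-- A behaviour whose laws are dominated, up to mass `1 / 4`, by a common measure of mass at most
`2 ^ k / 2` forces a decoding error of at least `1 / 4`. -/
lemma quarter_le_error {n k : ℕ} {W : Word n → Measure (Counts n)}
    (hW : ∀ X, IsProbabilityMeasure (W X)) {Q : Measure (Counts n)}
    (hQ : 2 * Q Set.univ ≤ 2 ^ k) (hWQ : ∀ X s, W X s ≤ Q s + 1 / 4)
    (E : Word k → Word n) (D : Counts n → Word k) :
    1 / 4 ≤ (∑ m : Word k, W (E m) {y | D y ≠ m}) / 2 ^ k := by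
  set u : ℝ≥0∞ := 2 ^ k / 4 with hu
  have hu_top : u ≠ ∞ := by
    rw [hu]; exact ENNReal.div_ne_top (by simp) (by simp)
  have h4 : (4 : ℝ≥0∞) * u = 2 ^ k := by
    rw [hu]; exact ENNReal.mul_div_cancel (by simp) (by simp)
  have hQu : Q Set.univ ≤ 2 * u := by
    have : (2 : ℝ≥0∞) * Q Set.univ ≤ 2 * (2 * u) := by
      calc (2 : ℝ≥0∞) * Q Set.univ ≤ 2 ^ k := hQ
        _ = 2 * (2 * u) := by rw [← h4, ← mul_assoc]; norm_num
    exact (ENNReal.mul_le_mul_iff_right (by simp) (by simp)).1 this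
  have hsum : ∑ m : Word k, Q {y | D y = m} = Q Set.univ := by
    have hU : (Set.univ : Set (Counts n)) = ⋃ m ∈ (Finset.univ : Finset (Word k)), {y | D y = m} := by
      ext y; simp
    rw [hU, measure_biUnion_finset]
    · intro a _ b _ hab
      exact Set.disjoint_left.2 fun y hy hy' => hab (hy.symm.trans hy')
    · intro _ _; exact MeasurableSet.of_discrete
  have hcard : (∑ _m : Word k, (1 : ℝ≥0∞)) = 4 * u := by
    rw [h4]; simp
  have hquarter : (∑ _m : Word k, (1 / 4 : ℝ≥0∞)) = u := by
    rw [hu]; simp [div_eq_mul_inv]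
  -- With `u` a quarter of the number of messages, `Q` accounts for at most `2 * u` successes and
  -- the slack 1/4 for `u`. Cancelling `3 * u` avoids subtraction in `ℝ≥0∞`.
  have key : u + 3 * u ≤ (∑ m : Word k, W (E m) {y | D y ≠ m}) + 3 * u := by
    calc u + 3 * u = ∑ _m : Word k, (1 : ℝ≥0∞) := by rw [hcard]; ring
      _ ≤ ∑ m : Word k, (W (E m) {y | D y ≠ m} + (Q {y | D y = m} + 1 / 4)) := by
        refine Finset.sum_le_sum fun m _ => ?_
        have := hW (E m)
        calc (1 : ℝ≥0∞) = W (E m) Set.univ := by simp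
          _ ≤ W (E m) ({y | D y ≠ m} ∪ {y | D y = m}) := by
            refine measure_mono fun y _ => ?_
            by_cases h : D y = m <;> simp [h]
          _ ≤ _ := (measure_union_le _ _).trans (by gcongr; exact hWQ _ _)
      _ = (∑ m : Word k, W (E m) {y | D y ≠ m}) + (Q Set.univ + u) := by
        rw [Finset.sum_add_distrib, Finset.sum_add_distrib, hsum, hquarter]
      _ ≤ _ := by
        gcongr
        calc Q Set.univ + u ≤ 2 * u + u := by gcongr
          _ = 3 * u := by ring
  have hfin := (ENNReal.add_le_add_iff_right (ENNReal.mul_ne_top (by simp) hu_top)).1 key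
  rw [ENNReal.le_div_iff_mul_le (by simp) (by simp)]
  calc 1 / 4 * 2 ^ k = u := by rw [hu, div_eq_mul_inv, div_eq_mul_inv, one_mul, mul_comm]
    _ ≤ _ := hfin

/-- A uniform lower bound for the error of all codes of large rate bounds the capacity. -/
lemma FiniteCapacity.of_uniform_bound {𝒞 : Channel} (C : ℝ≥0)
    (h : ∀ R : ℝ≥0, C < R → ∃ γ : ℝ≥0, 0 < γ ∧
      ∀ (M : ℕ+) (T k : ℕ), 0 < T → (R : ℝ) * T ≤ k →
        ∀ (E : Word k → Word (M * T)) (D : Counts (M * T) → Word k),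
          (γ : ℝ≥0∞) ≤ decodingError 𝒞 M E D) : FiniteCapacity 𝒞 := by
  refine ⟨C, ?_, h⟩
  refine iSup_le fun M => iSup_le fun S => iSup_le fun hS => ?_
  by_contra! hlt
  obtain ⟨R, hCR, hR⟩ := ENNReal.lt_iff_exists_nnreal_btwn.1 hlt
  obtain ⟨γ, hγ, hb⟩ := h R (by exact_mod_cast hCR)
  have hfreq := frequently_lt_of_lt_limsup (by isBoundedDefault) hR
  have hev := (ENNReal.tendsto_nhds_zero.1 hS (γ / 2 : ℝ≥0) (by simpa using hγ.ne'))
  obtain ⟨T, hT, hle, hT0⟩ := (hfreq.and_eventually (hev.and (eventually_gt_atTop 0))).exists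
  have hT' : (0 : ℝ) < T := by exact_mod_cast hT0
  have hrate : (R : ℝ) * T ≤ S.bits T := by
    have h1 := (ENNReal.lt_div_iff_mul_lt (by simp) (by simp)).1 hT
    have h2 : R * (T : ℝ≥0) < (S.bits T : ℝ≥0) := by exact_mod_cast h1
    exact_mod_cast h2.le
  have h3 := (hb M T _ hT0 hrate (S.enc T) (S.dec T)).trans hle
  have h4 : γ ≤ γ / 2 := by exact_mod_cast h3
  exact absurd (NNReal.half_lt_self hγ.ne') (not_lt.2 h4)

/-- The domination criterion for finite capacity. Only fine discretizations matter. -/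
lemma FiniteCapacity.of_dominated {𝒞 : Channel} (hne : ∀ M n, (𝒞 M n).Nonempty)
    (hprob : ∀ M n, ∀ W ∈ 𝒞 M n, ∀ X, IsProbabilityMeasure (W X)) (K M₀ : ℕ)
    (h : ∀ (M : ℕ+) (T : ℕ), 0 < T → M₀ ≤ M → ∃ W ∈ 𝒞 M (M * T), ∃ Q : Measure (Counts (M * T)),
      Q Set.univ ≤ 2 ^ (K * T) ∧ ∀ X s, W X s ≤ Q s + 1 / 4) : FiniteCapacity 𝒞 := by
  -- The extra 1 supplies, since `T ≥ 1`, the one additional bit that makes the mass of `Q` at most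
  -- half of `2 ^ k`.
  refine FiniteCapacity.of_uniform_bound ((max K M₀ : ℕ) + 1) fun R hR => ⟨1 / 4, by simp, ?_⟩
  intro M T k hT hk E D
  have hk' : max K M₀ * T + 1 ≤ k := by
    have h1 : ((max K M₀ : ℕ) + 1 : ℝ) ≤ R := by exact_mod_cast hR.le
    have h2 : (1 : ℝ) ≤ T := by exact_mod_cast hT
    have h3 : ((max K M₀ : ℕ) + 1 : ℝ) * T ≤ k :=
      (mul_le_mul_of_nonneg_right h1 (by linarith)).trans hk
    have h4 : ((max K M₀ * T + 1 : ℕ) : ℝ) ≤ k := by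
      push_cast at h3 ⊢; nlinarith
    exact_mod_cast h4
  obtain ⟨W, hW, Q, hQ, hWQ⟩ : ∃ W ∈ 𝒞 M (M * T), ∃ Q : Measure (Counts (M * T)),
      Q Set.univ ≤ 2 ^ (max K M₀ * T) ∧ ∀ X s, W X s ≤ Q s + 1 / 4 := by
    by_cases hM : M₀ ≤ M
    · obtain ⟨W, hW, Q, hQ, hWQ⟩ := h M T hT hM
      refine ⟨W, hW, Q, hQ.trans ?_, hWQ⟩
      exact pow_le_pow_right₀ (by norm_num) (Nat.mul_le_mul_right _ (le_max_left _ _))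
    -- On a coarse grid there are only `2 ^ (M * T)` codewords, and the sum of all their output laws
    -- serves as `Q`.
    · obtain ⟨W, hW⟩ := hne M (M * T)
      refine ⟨W, hW, ∑ X, W X, ?_, fun X s => ?_⟩
      · have : ∀ X, W X Set.univ = 1 := fun X => (hprob _ _ W hW X).measure_univ
        simp only [Measure.coe_finsetSum, Finset.sum_apply, this]
        simp only [Finset.sum_const, Finset.card_univ, Fintype.card_pi, Fintype.card_bool,
          Finset.prod_const, Fintype.card_fin, nsmul_eq_mul, mul_one, Nat.cast_pow, Nat.cast_ofNat]
        exact pow_le_pow_right₀ (by norm_num)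
          (Nat.mul_le_mul_right _ ((not_le.1 hM).le.trans (le_max_right _ _)))
      · simp only [Measure.coe_finsetSum, Finset.sum_apply]
        exact (Finset.single_le_sum (f := fun X => W X s) (by simp) (Finset.mem_univ X)).trans
          le_self_add
  have hQ2 : 2 * Q Set.univ ≤ 2 ^ k :=
    calc 2 * Q Set.univ ≤ 2 * 2 ^ (max K M₀ * T) := by gcongr
      _ = 2 ^ (max K M₀ * T + 1) := by ring
      _ ≤ 2 ^ k := pow_le_pow_right₀ (by norm_num) hk'
  have := quarter_le_error (hprob _ _ W hW) hQ2 hWQ E D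
  calc ((1 / 4 : ℝ≥0) : ℝ≥0∞) = 1 / 4 := by simp
    _ ≤ _ := this
    _ ≤ _ := le_iSup₂ (f := fun W (_ : W ∈ 𝒞 M (M * T)) =>
      (∑ m : Word k, W (E m) {y | D y ≠ m}) / 2 ^ k) W hW

/-- More strategies can only increase the supremum that defines the decoding error. -/
lemma FiniteCapacity.mono {𝒞 𝒞' : Channel} (h : ∀ M n, 𝒞 M n ⊆ 𝒞' M n)
    (h𝒞 : FiniteCapacity 𝒞) : FiniteCapacity 𝒞' := by
  obtain ⟨C, -, hC⟩ := h𝒞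
  refine FiniteCapacity.of_uniform_bound C fun R hR => ?_
  obtain ⟨γ, hγ, hb⟩ := hC R hR
  exact ⟨γ, hγ, fun M T k hT hk E D => (hb M T k hT hk E D).trans
    (biSup_mono fun W hW => h M _ hW)⟩

/-! ### Product measures and thinning of the ones -/

/-- To compare measures on sequences it is enough to compare the masses of points. -/
lemma measure_le_of_singleton_le {α : Type*} [MeasurableSpace α] [Countable α]
    [MeasurableSingletonClass α] {μ ν : Measure α} (h : ∀ a, μ {a} ≤ ν {a}) (s : Set α) :
    μ s ≤ ν s := by
  have key : ∀ ρ : Measure α, ρ s = ∑' a : s, ρ {(a : α)} := fun ρ => by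
    conv_lhs => rw [← Set.biUnion_of_singleton s]
    exact measure_biUnion s.to_countable
      (fun a _ b _ hab => Set.disjoint_singleton.2 hab) fun _ _ => measurableSet_singleton _
  rw [key, key]
  exact ENNReal.tsum_le_tsum fun a => h a

/-- If the coordinates other than the ends of intervals of length `L` carry mass at most one and
the others at most `2 ^ K`, the product has mass exponential in the number of intervals. -/
lemma pi_univ_le_of_ticks {n L m K : ℕ} (hL : 0 < L) (hn : n ≤ L * m) {ρ : Fin n → Measure ℕ}
    [∀ i, SigmaFinite (ρ i)] (h1 : ∀ i : Fin n, ¬ L ∣ (i : ℕ) + 1 → ρ i Set.univ ≤ 1)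
    (h2 : ∀ i : Fin n, L ∣ (i : ℕ) + 1 → ρ i Set.univ ≤ 2 ^ K) :
    Measure.pi ρ Set.univ ≤ 2 ^ (K * m) := by
  classical
  rw [Measure.pi_univ]
  have hcard : (Finset.univ.filter fun i : Fin n => L ∣ (i : ℕ) + 1).card ≤ m := by
    -- A tick `i + 1 = L * a` has `i / L = a - 1`, so distinct ticks lie in distinct intervals.
    calc _ ≤ (Finset.range m).card := by
          refine Finset.card_le_card_of_injOn (fun i => (i : ℕ) / L) ?_ ?_
          · intro i _
            simp only [Finset.coe_range, Set.mem_Iio]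
            exact Nat.div_lt_of_lt_mul (i.2.trans_le hn)
          · intro i hi j hj hij
            simp only [Finset.coe_filter, Finset.mem_univ, true_and, Set.mem_ofPred_eq] at hi hj hij
            obtain ⟨a, ha⟩ := hi
            obtain ⟨b, hb⟩ := hj
            have e : ∀ (i a : ℕ), i + 1 = L * a → i / L + 1 = a := by
              intro i a h
              have : 0 < a := Nat.pos_of_ne_zero (by rintro rfl; simp at h)
              obtain ⟨c, rfl⟩ : ∃ c, a = c + 1 := ⟨a - 1, by omega⟩
              have : i = L * c + (L - 1) := by rw [mul_add] at h; omega
              rw [this, Nat.mul_add_div hL, Nat.div_eq_of_lt (by omega)]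
            have : a = b := by rw [← e _ _ ha, ← e _ _ hb, hij]
            apply Fin.ext
            rw [this] at ha; omega
      _ = m := Finset.card_range m
  calc ∏ i, ρ i Set.univ ≤ ∏ i : Fin n, (if L ∣ (i : ℕ) + 1 then (2 : ℝ≥0∞) ^ K else 1) := by
        refine Finset.prod_le_prod' fun i _ => ?_
        split_ifs with h
        · exact h2 i h
        · exact h1 i h
    _ = (2 ^ K) ^ (Finset.univ.filter fun i : Fin n => L ∣ (i : ℕ) + 1).card := by
        rw [Finset.prod_ite]; simp
    _ ≤ (2 ^ K) ^ m := pow_le_pow_right₀ (one_le_pow₀ (by norm_num)) hcard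
    _ = 2 ^ (K * m) := by rw [← pow_mul]

/-- Every finite set can be thinned so that all fibres of a labelling have a size which is a
multiple of `q`, and fewer than `q` elements are removed from each fibre. -/
lemma exists_subset_fiber_card {ι κ : Type*} [DecidableEq ι] [DecidableEq κ] (A : Finset ι)
    (g : ι → κ) (q : ℕ) : ∃ A' ⊆ A, ∀ t, (A'.filter (g · = t)).card =
      q * ((A.filter (g · = t)).card / q) := by
  have h : ∀ t, ∃ S ⊆ A.filter (g · = t), S.card = q * ((A.filter (g · = t)).card / q) :=
    fun t => Finset.exists_subset_card_eq (Nat.mul_div_le _ _)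
  choose S hS hc using h
  refine ⟨A.filter fun j => j ∈ S (g j), Finset.filter_subset _ _, fun t => ?_⟩
  rw [← hc t]
  congr 1
  ext j
  simp only [Finset.mem_filter]
  constructor
  · rintro ⟨⟨_, h⟩, rfl⟩; exact h
  · intro h
    obtain ⟨h1, rfl⟩ := Finset.mem_filter.1 (hS t h)
    exact ⟨⟨h1, h⟩, rfl⟩

lemma card_sdiff_filter_le {ι κ : Type*} [DecidableEq ι] [DecidableEq κ] {A A' : Finset ι}
    {g : ι → κ} {q : ℕ} (hq : 0 < q) (hA : A' ⊆ A) {t : κ}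
    (h : (A'.filter (g · = t)).card = q * ((A.filter (g · = t)).card / q)) :
    ((A \ A').filter (g · = t)).card ≤ q - 1 := by
  have h1 : (A \ A').filter (g · = t) = A.filter (g · = t) \ A'.filter (g · = t) := by
    ext j; simp only [Finset.mem_filter, Finset.mem_sdiff]; tauto
  rw [h1, Finset.card_sdiff_of_subset (Finset.filter_subset_filter _ hA), h]
  have := Nat.mod_lt (A.filter (g · = t)).card hq
  have := Nat.div_add_mod (A.filter (g · = t)).card q
  omega

/-- The noise that turns the ones outside `A` into zeros. -/
def killNoise {n : ℕ} (X : Word n) (A : Finset (Fin n)) : Word n := fun j => X j && !decide (j ∈ A)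

lemma received_killNoise {n : ℕ} {X : Word n} {A : Finset (Fin n)} (hA : ∀ j ∈ A, X j = true)
    (Δ : Counts n) (i : Fin n) :
    received X (killNoise X A) Δ i = (A.filter fun j : Fin n => (j : ℕ) + Δ j = i).card := by
  rw [received, Finset.card_eq_sum_ones]
  have hx : ∀ j, (xor (X j) (killNoise X A j)).toNat = if j ∈ A then 1 else 0 := by
    intro j
    by_cases hj : j ∈ A
    · simp [killNoise, hj, hA j hj]
    · cases h : X j <;> simp [killNoise, hj, h]
  simp only [hx]
  rw [Finset.sum_ite_mem, ← Finset.card_eq_sum_ones, Finset.card_eq_sum_ones]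
  congr 1
  ext j; simp [and_comm]

lemma flips_killNoise {n : ℕ} (X : Word n) (A : Finset (Fin n)) :
    flips (killNoise X A) = ((Finset.univ.filter fun j => X j = true) \ A).card := by
  rw [flips]
  congr 1
  ext j; simp [killNoise]

lemma card_le_mul_of_fiber_card_le {n L m c : ℕ} (hn : n ≤ L * m) (S : Finset (Fin n))
    (h : ∀ t, (S.filter fun j : Fin n => (j : ℕ) / L = t).card ≤ c) : S.card ≤ m * c := by
  have hmaps : ∀ j ∈ S, (j : ℕ) / L ∈ Finset.range m := fun j _ =>
    Finset.mem_range.2 (Nat.div_lt_of_lt_mul (j.2.trans_le hn))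
  rw [Finset.card_eq_sum_card_fiberwise hmaps]
  calc _ ≤ ∑ _t ∈ Finset.range m, c := Finset.sum_le_sum fun t _ => h t
    _ = m * c := by simp

lemma card_fiber_div_le {n L : ℕ} (hL : 0 < L) (S : Finset (Fin n)) (t : ℕ) :
    (S.filter fun j : Fin n => (j : ℕ) / L = t).card ≤ L := by
  calc _ ≤ (Finset.Ico (L * t) (L * (t + 1))).card := by
        refine Finset.card_le_card_of_injOn (fun j => (j : ℕ)) ?_ (fun a _ b _ h => Fin.ext h)
        intro j hj
        obtain ⟨-, rfl⟩ := Finset.mem_filter.1 hj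
        simp only [Finset.coe_Ico, Set.mem_Ico]
        exact ⟨Nat.mul_div_le _ _, Nat.lt_mul_div_succ _ hL⟩
    _ = L := by simp [mul_add]

/-! ### Adversarial delay and adversarial noise -/

theorem finiteCapacity_advDelayAdvNoise {ε : ℝ} (hε : 0 < ε) :
    FiniteCapacity (advDelayAdvNoise ε) := by
  classical
  refine FiniteCapacity.of_dominated (fun M n => ?_) ?_ (⌈1 / ε⌉₊ + 1) 0 ?_
  · refine ⟨fun X => _, fun _ _ => 0, fun _ _ _ => false, by simp, fun X Δ => ?_, fun X => rfl⟩
    simp only [flips]; simp; positivity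
  · rintro M n W ⟨d, ν, -, -, h⟩ X
    rw [h]; infer_instance
  intro M T hT _
  set S := ⌈1 / ε⌉₊ with hS
  -- Both sides of the floor matter: `q > ε M` bounds the number `M / q` of quanta per unit by `1 /
  -- ε`, while `q - 1 ≤ ε M` keeps the erasures within the noise budget.
  set q := ⌊ε * M⌋₊ + 1 with hq
  have hM : 0 < (M : ℕ) := M.pos
  have hMr : (0 : ℝ) < (M : ℕ) := by exact_mod_cast hM
  have hqM : (M : ℕ) / q ≤ S := by
    have h1 : ε * (M : ℕ) < q := by rw [hq]; push_cast; exact Nat.lt_floor_add_one _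
    have h2 : (((M : ℕ) / q : ℕ) : ℝ) ≤ (M : ℕ) / q := Nat.cast_div_le
    have h3 : ((M : ℕ) : ℝ) / q ≤ 1 / ε := by
      rw [div_le_div_iff₀ (by linarith [mul_pos hε hMr]) hε]; linarith
    exact_mod_cast (h2.trans h3).trans (Nat.le_ceil _)
  set ones : Word (M * T) → Finset (Fin (M * T)) := fun X => Finset.univ.filter fun j => X j = true
    with hones
  have hA := fun X => exists_subset_fiber_card (ones X) (fun j : Fin (M * T) => (j : ℕ) / M) q
  choose A hAsub hAcard using hA
  -- The symbol leaves at the last instant of its own unit. Instants are counted from 0, so these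
  -- are the `i` with `M ∣ i + 1`.
  set d : Counts (M * T) := fun j => M * (j / M) + (M - 1) - j with hd
  have hdj : ∀ j : Fin (M * T), (j : ℕ) + d j = M * (j / M) + (M - 1) := by
    intro j
    have := Nat.div_add_mod (j : ℕ) M
    have := Nat.mod_lt (j : ℕ) hM
    simp only [hd]; omega
  have hAone : ∀ X, ∀ j ∈ A X, X j = true := fun X j hj => by
    simpa [hones] using hAsub X hj
  let ρ : Fin (M * T) → Measure ℕ := fun i => if (M : ℕ) ∣ (i : ℕ) + 1 then
    ∑ s ∈ Finset.range (S + 1), Measure.dirac (q * s) else Measure.dirac 0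
  have hρfin : ∀ i, IsFiniteMeasure (ρ i) := by
    intro i; simp only [ρ]; split_ifs <;> infer_instance
  refine ⟨_, ⟨fun _ => d, fun X _ => killNoise X (A X), ?_, ?_, fun X => rfl⟩,
    Measure.pi ρ, ?_, fun X s => ?_⟩
  · intro X j
    have := hdj j
    have := Nat.mul_div_le (j : ℕ) M
    have := Nat.lt_mul_div_succ (j : ℕ) hM
    rw [mul_add] at this
    change d j ≤ M
    omega
  · intro X Δ
    rw [flips_killNoise]
    have h1 := card_le_mul_of_fiber_card_le (le_refl (M * T : ℕ)) (ones X \ A X)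
      (c := q - 1) fun t => card_sdiff_filter_le (by omega) (hAsub X) (hAcard X t)
    have h2 : ((q - 1 : ℕ) : ℝ) ≤ ε * (M : ℕ) := by
      rw [hq, Nat.add_sub_cancel]; exact Nat.floor_le (by positivity)
    calc (((ones X \ A X).card : ℕ) : ℝ) ≤ ((T * (q - 1) : ℕ) : ℝ) := by exact_mod_cast h1
      _ ≤ T * (ε * (M : ℕ)) := by rw [Nat.cast_mul]; gcongr
      _ = ε * ((M * T : ℕ) : ℝ) := by push_cast; ring
  · refine pi_univ_le_of_ticks hM le_rfl (fun i hi => ?_) fun i hi => ?_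
    · simp [ρ, hi]
    · simp only [ρ, hi, if_true, Measure.coe_finsetSum, Finset.sum_apply, measure_univ,
        Finset.sum_const, Finset.card_range, nsmul_eq_mul, mul_one]
      exact_mod_cast (Nat.lt_two_pow_self (n := S + 1)).le
  · refine (measure_le_of_singleton_le (fun y => ?_) s).trans le_self_add
    by_cases hy : received X (killNoise X (A X)) d = y
    · subst hy
      rw [Measure.pi_singleton]
      refine prob_le_one.trans (Finset.one_le_prod' fun i _ => ?_)
      rw [received_killNoise (hAone X)]
      by_cases hi : (M : ℕ) ∣ (i : ℕ) + 1
      · obtain ⟨t, ht⟩ := hi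
        have ht0 : 0 < t := Nat.pos_of_ne_zero (by rintro rfl; simp at ht)
        obtain ⟨t, rfl⟩ : ∃ t', t = t' + 1 := ⟨t - 1, by omega⟩
        have hfib : ((A X).filter fun j : Fin (M * T) => (j : ℕ) + d j = i) =
            (A X).filter fun j : Fin (M * T) => (j : ℕ) / M = t := by
          refine Finset.filter_congr fun j _ => ?_
          rw [hdj]
          rw [mul_add] at ht
          constructor
          · intro h; exact Nat.eq_of_mul_eq_mul_left hM (by omega)
          · intro h; rw [h]; omega
        rw [hfib, hAcard]
        have hi : (M : ℕ) ∣ (i : ℕ) + 1 := ⟨_, ht⟩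
        simp only [ρ, hi, if_true, Measure.coe_finsetSum, Finset.sum_apply]
        set v := ((ones X).filter fun j : Fin (M * T) => (j : ℕ) / M = t).card / q with hv
        have hvS : v ∈ Finset.range (S + 1) := by
          rw [Finset.mem_range]
          have := (Nat.div_le_div_right (c := q) (card_fiber_div_le hM (ones X) t)).trans hqM
          omega
        calc (1 : ℝ≥0∞) = Measure.dirac (q * v) {q * v} := by simp
          _ ≤ _ := Finset.single_le_sum
            (f := fun s => (Measure.dirac (q * s) : Measure ℕ) {q * v}) (by simp) hvS
      · have hempty : ((A X).filter fun j : Fin (M * T) => (j : ℕ) + d j = i) = ∅ := by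
          refine Finset.filter_eq_empty_iff.2 fun j _ h => hi ⟨j / M + 1, ?_⟩
          rw [← h, hdj, mul_add]; omega
        simp [ρ, hi, hempty]
    · rw [Measure.dirac_apply' _ (measurableSet_singleton _), Set.indicator_of_notMem (by simpa using hy)]
      exact zero_le

/-! ### Local limit bounds for sums of noisy bits -/

/-- Lorentzian weights of width `s` have total mass `O(s)`. -/
lemma sum_lorentzian_le {s : ℝ} (hs : 1 ≤ s) (a : ℝ) (N : ℕ) :
    ∑ y ∈ Finset.range N, 1 / (1 + ((y - a) / s) ^ 2) ≤ 3 * Real.pi * s := by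
  have hs0 : 0 < s := by linarith
  -- Comparison with a telescoping sum of arctangents. The mean value point is within `1 / s ≤ 1` of
  -- the left end, which changes the density by a factor of at most 3.
  have hstep : ∀ y : ℕ, 1 / (1 + (((y : ℝ) - a) / s) ^ 2) ≤
      3 * s * (Real.arctan (((y + 1 : ℕ) - a) / s) - Real.arctan ((y - a) / s)) := by
    intro y
    set t := ((y : ℝ) - a) / s with ht
    have ht1 : (((y + 1 : ℕ) : ℝ) - a) / s = t + 1 / s := by
      rw [ht]; push_cast; field_simp; ring
    rw [ht1]
    have hδ : 0 < 1 / s := by positivity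
    have hδ1 : 1 / s ≤ 1 := by rw [div_le_one hs0]; exact hs
    obtain ⟨c, hc, hce⟩ := exists_hasDerivAt_eq_slope Real.arctan (fun x => 1 / (1 + x ^ 2))
      (show t < t + 1 / s by linarith) Real.continuous_arctan.continuousOn
      (fun x _ => Real.hasDerivAt_arctan x)
    have hdiff : Real.arctan (t + 1 / s) - Real.arctan t = 1 / (1 + c ^ 2) * (1 / s) := by
      rw [hce, add_sub_cancel_left, div_mul_cancel₀ _ hδ.ne']
    rw [hdiff]
    have h1 : 1 + c ^ 2 ≤ 3 * (1 + t ^ 2) := by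
      obtain ⟨h, h'⟩ := hc
      have h2 : (c - t) ^ 2 ≤ 1 := by
        rw [sq_le_one_iff_abs_le_one, abs_le]; constructor <;> linarith
      nlinarith [sq_nonneg (c - 2 * t)]
    have h2 : 3 * s * (1 / (1 + c ^ 2) * (1 / s)) = 3 / (1 + c ^ 2) := by field_simp
    rw [h2, div_le_div_iff₀ (by positivity) (by positivity)]
    linarith
  calc _ ≤ ∑ y ∈ Finset.range N,
        3 * s * (Real.arctan (((y + 1 : ℕ) - a) / s) - Real.arctan ((y - a) / s)) :=
        Finset.sum_le_sum fun y _ => hstep y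
    _ = 3 * s * (Real.arctan ((N - a) / s) - Real.arctan (((0 : ℕ) - a) / s)) := by
        rw [← Finset.mul_sum, Finset.sum_range_sub fun y : ℕ => Real.arctan ((y - a) / s)]
    _ ≤ 3 * s * (Real.pi / 2 - -(Real.pi / 2)) := by
        gcongr
        · exact (Real.arctan_lt_pi_div_two _).le
        · exact (Real.neg_pi_div_two_lt_arctan _).le
    _ = 3 * Real.pi * s := by ring

lemma integral_exp_int_mul (k : ℤ) :
    ∫ θ in (-Real.pi)..Real.pi, Complex.exp (k * Complex.I * θ) =
      if k = 0 then 2 * (Real.pi : ℂ) else 0 := by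
  split_ifs with hk
  · simp [hk]; ring
  · have hc : (k : ℂ) * Complex.I ≠ 0 := mul_ne_zero (by exact_mod_cast hk) Complex.I_ne_zero
    rw [integral_exp_mul_complex hc]
    have : (k : ℂ) * Complex.I * (Real.pi : ℂ) =
        k * Complex.I * ((-Real.pi : ℝ) : ℂ) + k * (2 * Real.pi * Complex.I) := by
      push_cast; ring
    rw [this, Complex.exp_periodic.int_mul k]
    simp

/-- Fourier inversion for random variables with finitely many integral values. -/
lemma two_pi_mul_measureReal_eq {Ω : Type*} [Fintype Ω] [MeasurableSpace Ω]
    [MeasurableSingletonClass Ω] (μ : Measure Ω) [IsFiniteMeasure μ] (Y : Ω → ℕ) (y : ℕ) :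
    (2 * Real.pi * μ.real {ω | Y ω = y} : ℂ) = ∫ θ in (-Real.pi)..Real.pi,
      Complex.exp (-(y * Complex.I * θ)) * ∫ ω, Complex.exp (Y ω * Complex.I * θ) ∂μ := by
  have h1 : ∀ θ : ℝ, Complex.exp (-(y * Complex.I * θ)) * ∫ ω, Complex.exp (Y ω * Complex.I * θ) ∂μ
      = ∑ ω, (μ.real {ω} : ℂ) * Complex.exp (((Y ω - y : ℤ) : ℂ) * Complex.I * θ) := by
    intro θ
    rw [integral_fintype Integrable.of_finite, Finset.mul_sum]
    refine Finset.sum_congr rfl fun ω _ => ?_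
    rw [Complex.real_smul, mul_left_comm, ← Complex.exp_add]
    congr 2; push_cast; ring
  simp_rw [h1]
  rw [intervalIntegral.integral_finsetSum]
  · simp_rw [intervalIntegral.integral_const_mul, integral_exp_int_mul]
    have h2 : μ.real {ω | Y ω = y} = ∑ ω ∈ Finset.univ.filter (fun ω => Y ω = y), μ.real {ω} := by
      rw [sum_measureReal_singleton]; simp
    rw [h2, Finset.sum_filter]
    push_cast
    rw [Finset.mul_sum]
    refine Finset.sum_congr rfl fun ω _ => ?_
    have : ((Y ω : ℤ) - y = 0) ↔ Y ω = y := by omega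
    simp only [this]
    split_ifs
    · ring
    · simp
  · intro ω _
    exact (by fun_prop : Continuous fun θ : ℝ => (μ.real {ω} : ℂ) *
      Complex.exp (((Y ω - y : ℤ) : ℂ) * Complex.I * θ)).intervalIntegrable _ _

/-- The bit received for the symbol `x` under the noise bit `b`. -/
def noisy (x b : Bool) : ℕ := (xor x b).toNat

instance (ε : unitInterval) (n : ℕ) : IsProbabilityMeasure (noiseLaw ε n) := by
  unfold noiseLaw; infer_instance

lemma integral_bernoulli {E : Type*} [NormedAddCommGroup E] [NormedSpace ℝ E] [CompleteSpace E]
    (ε : unitInterval) (f : Bool → E) :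
    ∫ b, f b ∂(bernoulliMeasure true false ε) = (ε : ℝ) • f true + (1 - ε : ℝ) • f false := by
  rw [integral_fintype Integrable.of_finite, Fintype.sum_bool]
  simp

/-- For `p + r = 1` the squared modulus of `p * exp (i θ) + r` is `1 - 2 p r (1 - cos θ)`, and `1 -
cos θ ≥ 2 θ² / π²` on `[-π, π]`. Both values of the symbol give the same product `p r = ε (1 - ε)`.
-/
lemma norm_charFun_noisy_le (ε : unitInterval) (x : Bool) {θ : ℝ} (hθ : |θ| ≤ Real.pi) :
    ‖∫ b, Complex.exp (noisy x b * Complex.I * θ) ∂(bernoulliMeasure true false ε)‖ ≤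
      Real.exp (-(2 * ε * (1 - ε) / Real.pi ^ 2) * θ ^ 2) := by
  have hcos := Real.cos_le_one_sub_mul_cos_sq hθ
  have hε0 : (0 : ℝ) ≤ ε := ε.2.1
  have hε1 : (0 : ℝ) ≤ 1 - ε := by linarith [ε.2.2]
  have hmix : ∀ p r : ℝ, p + r = 1 → p * r = ε * (1 - ε) →
      ‖(p : ℂ) * Complex.exp (θ * Complex.I) + r‖ ≤
        Real.exp (-(2 * ε * (1 - ε) / Real.pi ^ 2) * θ ^ 2) := by
    intro p r hpr hpr'
    rw [← sq_le_sq₀ (norm_nonneg _) (Real.exp_nonneg _), ← Complex.normSq_eq_norm_sq,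
      Complex.normSq_apply, ← Real.exp_nat_mul]
    simp only [Complex.add_re, Complex.mul_re, Complex.ofReal_re, Complex.ofReal_im, zero_mul,
      sub_zero, Complex.add_im, Complex.mul_im, add_zero, Complex.exp_ofReal_mul_I_re,
      Complex.exp_ofReal_mul_I_im]
    have hsc := Real.sin_sq_add_cos_sq θ
    have h1 : (p * Real.cos θ + r) * (p * Real.cos θ + r) + (p * Real.sin θ) * (p * Real.sin θ)
        = 1 - 2 * (p * r) * (1 - Real.cos θ) := by
      have : (p + r) ^ 2 = 1 := by rw [hpr]; norm_num
      linear_combination p ^ 2 * hsc + this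
    rw [h1, hpr']
    refine le_trans ?_ (Real.add_one_le_exp _)
    have h2 : 0 ≤ (ε : ℝ) * (1 - ε) := mul_nonneg hε0 hε1
    have h3 := mul_le_mul_of_nonneg_left hcos h2
    push_cast
    have h4 : 2 * (-(2 * (ε : ℝ) * (1 - ε) / Real.pi ^ 2) * θ ^ 2) =
      -2 * (ε * (1 - ε)) * (2 / Real.pi ^ 2 * θ ^ 2) := by ring
    rw [h4]; nlinarith
  rw [integral_bernoulli]
  cases x
  · convert! hmix ε (1 - ε) (by ring) rfl using 2
    simp [noisy, mul_comm]
  · convert! hmix (1 - ε) ε (by ring) (by ring) using 2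
    simp [noisy, mul_comm, add_comm]

/-- The number of ones received from the symbols in `D`. -/
def arrivals {n : ℕ} (X : Word n) (D : Finset (Fin n)) (ξ : Word n) : ℕ :=
  ∑ j ∈ D, noisy (X j) (ξ j)

/-- The expected number of ones received from a symbol. -/
def meanBit (ε : unitInterval) (x : Bool) : ℝ := if x then 1 - ε else ε

/-- The local limit bound: the number of ones received from `N` symbols takes any given value with
probability `O(1 / √N)`. -/
lemma measureReal_arrivals_le {ε : unitInterval} (h0 : 0 < ε) (h1 : ε < 1) {n : ℕ} (X : Word n)
    {D : Finset (Fin n)} (hD : D.Nonempty) (y : ℕ) :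
    (noiseLaw ε n).real {ξ | arrivals X D ξ = y} ≤
      √(Real.pi ^ 3 / (2 * ε * (1 - ε) * D.card)) := by
  set b : ℝ := 2 * ε * (1 - ε) / Real.pi ^ 2 with hb
  have hε0 : (0 : ℝ) < ε := h0
  have hε1 : (0 : ℝ) < 1 - ε := by
    have : (ε : ℝ) < 1 := h1
    linarith
  have hpi := Real.pi_pos
  have hcard : (0 : ℝ) < D.card := by exact_mod_cast hD.card_pos
  have hb0 : 0 < b := by positivity
  have hchar : ∀ θ : ℝ, |θ| ≤ Real.pi →
      ‖∫ ξ, Complex.exp (arrivals X D ξ * Complex.I * θ) ∂(noiseLaw ε n)‖ ≤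
        Real.exp (-(b * D.card) * θ ^ 2) := by
    intro θ hθ
    have h2 : ∀ ξ : Word n, Complex.exp (arrivals X D ξ * Complex.I * θ) =
        ∏ j, (if j ∈ D then Complex.exp (noisy (X j) (ξ j) * Complex.I * θ) else 1) := by
      intro ξ
      rw [Finset.prod_ite_mem, Finset.univ_inter, ← Complex.exp_sum, arrivals]
      push_cast
      rw [Finset.sum_mul, Finset.sum_mul]
    simp_rw [h2]
    rw [noiseLaw, integral_fintype_prod_eq_prod (fun j (a : Bool) =>
      (if j ∈ D then Complex.exp (noisy (X j) a * Complex.I * θ) else 1)), norm_prod]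
    calc _ ≤ ∏ j, (if j ∈ D then Real.exp (-b * θ ^ 2) else 1) := by
          refine Finset.prod_le_prod (fun _ _ => norm_nonneg _) fun j _ => ?_
          split_ifs
          · exact norm_charFun_noisy_le ε (X j) hθ
          · simp
      _ = _ := by
          rw [Finset.prod_ite_mem, Finset.univ_inter, Finset.prod_const, ← Real.exp_nat_mul]
          congr 1; ring
  have hint : Integrable fun θ : ℝ => Real.exp (-(b * D.card) * θ ^ 2) :=
    integrable_exp_neg_mul_sq (by positivity)
  -- Fourier inversion bounds the point mass by the integral of the modulus of the characteristic
  -- function, hence by a Gaussian integral over the whole line.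
  have hmain : 2 * Real.pi * (noiseLaw ε n).real {ξ | arrivals X D ξ = y} ≤
      √(Real.pi / (b * D.card)) := by
    calc 2 * Real.pi * (noiseLaw ε n).real {ξ | arrivals X D ξ = y}
        = ‖(2 * Real.pi * (noiseLaw ε n).real {ξ | arrivals X D ξ = y} : ℂ)‖ := by
          norm_cast
          rw [Real.norm_of_nonneg (by positivity)]
      _ ≤ ∫ θ in (-Real.pi)..Real.pi, Real.exp (-(b * D.card) * θ ^ 2) := by
          rw [two_pi_mul_measureReal_eq]
          refine intervalIntegral.norm_integral_le_of_norm_le (by linarith) ?_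
            hint.intervalIntegrable
          refine Eventually.of_forall fun θ hθ => ?_
          rw [norm_mul]
          have : ‖Complex.exp (-(y * Complex.I * θ))‖ = 1 := by
            rw [show (-(y * Complex.I * θ) : ℂ) = ((-(y * θ) : ℝ) : ℂ) * Complex.I by
              push_cast; ring, Complex.norm_exp_ofReal_mul_I]
          rw [this, one_mul]
          exact hchar θ (abs_le.2 ⟨hθ.1.le, hθ.2⟩)
      _ ≤ ∫ θ : ℝ, Real.exp (-(b * D.card) * θ ^ 2) := by
          rw [intervalIntegral.integral_of_le (by linarith)]
          exact setIntegral_le_integral hint (Eventually.of_forall fun _ => (Real.exp_pos _).le)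
      _ = _ := integral_gaussian _
  have hle : (noiseLaw ε n).real {ξ | arrivals X D ξ = y} ≤
      2 * Real.pi * (noiseLaw ε n).real {ξ | arrivals X D ξ = y} :=
    le_mul_of_one_le_left measureReal_nonneg (by linarith [Real.pi_gt_three])
  refine (hle.trans hmain).trans (le_of_eq ?_)
  congr 1
  rw [hb]; field_simp

lemma iIndepFun_noisy (ε : unitInterval) {n : ℕ} (X : Word n) :
    iIndepFun (fun j (ξ : Word n) => noisy (X j) (ξ j)) (noiseLaw ε n) :=
  iIndepFun_pi (X := fun j (b : Bool) => noisy (X j) b)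
    fun _ => (Measurable.of_discrete).aemeasurable

lemma indepFun_arrivals (ε : unitInterval) {n : ℕ} (X : Word n) {D D' : Finset (Fin n)}
    (h : Disjoint D D') : IndepFun (arrivals X D) (arrivals X D') (noiseLaw ε n) := by
  have := (iIndepFun_noisy ε X).indepFun_finset D D' h fun _ => Measurable.of_discrete
  have h2 := this.comp (φ := fun z : D → ℕ => ∑ j, z j) (ψ := fun z : D' → ℕ => ∑ j, z j)
    Measurable.of_discrete Measurable.of_discrete
  convert h2 using 1
  · ext ξ; simp [arrivals, ← Finset.sum_coe_sort D]
  · ext ξ; simp [arrivals, ← Finset.sum_coe_sort D']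

lemma measure_arrivals_eq_prod (ε : unitInterval) {n : ℕ} (X : Word n) (D : Fin n → Finset (Fin n))
    (h : Pairwise (Function.onFun Disjoint D)) (y : Counts n) :
    noiseLaw ε n {ξ | ∀ i, arrivals X (D i) ξ = y i} =
      ∏ i, noiseLaw ε n {ξ | arrivals X (D i) ξ = y i} := by
  have key : ∀ I : Finset (Fin n), noiseLaw ε n {ξ | ∀ i ∈ I, arrivals X (D i) ξ = y i} =
      ∏ i ∈ I, noiseLaw ε n {ξ | arrivals X (D i) ξ = y i} := by
    intro I
    induction I using Finset.induction_on with
    | empty => simp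
    | insert a I ha ih =>
      have hdisj : Disjoint (D a) (I.biUnion D) := by
        rw [Finset.disjoint_biUnion_right]
        exact fun i hi => h (by rintro rfl; exact ha hi)
      have h1 := ((iIndepFun_noisy ε X).indepFun_finset _ _ hdisj
        fun _ => Measurable.of_discrete).measure_inter_preimage_eq_mul
        {z | ∑ j : D a, z j = y a}
        -- The event must be expressed through the coordinates in the union of the blocks; the
        -- default 0 is never reached.
        {z | ∀ i ∈ I, ∑ j ∈ D i, (if hj : j ∈ I.biUnion D then z ⟨j, hj⟩ else 0) = y i}
        MeasurableSet.of_discrete MeasurableSet.of_discrete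
      have e1 : (fun (ξ : Word n) (j : D a) => noisy (X j) (ξ j)) ⁻¹' {z | ∑ j : D a, z j = y a} =
          {ξ | arrivals X (D a) ξ = y a} := by
        ext ξ; simp [arrivals, ← Finset.sum_coe_sort (D a)]
      have e2 : (fun (ξ : Word n) (j : I.biUnion D) => noisy (X j) (ξ j)) ⁻¹'
          {z | ∀ i ∈ I, ∑ j ∈ D i, (if hj : j ∈ I.biUnion D then z ⟨j, hj⟩ else 0) = y i} =
          {ξ | ∀ i ∈ I, arrivals X (D i) ξ = y i} := by
        ext ξ
        simp only [Set.mem_preimage, Set.mem_ofPred_eq, arrivals]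
        refine forall₂_congr fun i hi => ?_
        rw [Finset.sum_congr rfl fun j hj => dif_pos (Finset.mem_biUnion.2 ⟨i, hi, hj⟩)]
      rw [e1, e2, ih] at h1
      rw [Finset.prod_insert ha, ← h1]
      congr 1
      ext ξ; simp
  simpa using key Finset.univ

lemma integral_noisy (ε : unitInterval) {n : ℕ} (X : Word n) (j : Fin n) :
    ∫ ξ, (noisy (X j) (ξ j) : ℝ) ∂(noiseLaw ε n) = meanBit ε (X j) := by
  rw [noiseLaw, integral_comp_eval (μ := fun _ => bernoulliMeasure true false ε) (i := j)
    (f := fun b => (noisy (X j) b : ℝ)) (Measurable.of_discrete).aestronglyMeasurable,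
    integral_bernoulli]
  cases X j <;> simp [noisy, meanBit]

lemma memLp_word (ε : unitInterval) {n : ℕ} (f : Word n → ℝ) : MemLp f 2 (noiseLaw ε n) :=
  MemLp.of_discrete

/-- Chebyshev's inequality for the number of ones received. -/
lemma measureReal_abs_arrivals_sub_le (ε : unitInterval) {n : ℕ} (X : Word n) (D : Finset (Fin n))
    {c : ℝ} (hc : 0 < c) :
    (noiseLaw ε n).real {ξ | c ≤ |(arrivals X D ξ : ℝ) - ∑ j ∈ D, meanBit ε (X j)|} ≤
      D.card / c ^ 2 := by
  have hmean : ∫ ξ, (arrivals X D ξ : ℝ) ∂(noiseLaw ε n) = ∑ j ∈ D, meanBit ε (X j) := by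
    simp only [arrivals, Nat.cast_sum]
    rw [integral_finsetSum _ fun _ _ => Integrable.of_finite]
    exact Finset.sum_congr rfl fun j _ => integral_noisy ε X j
  have hvar : Var[fun ξ => (arrivals X D ξ : ℝ); noiseLaw ε n] ≤ D.card := by
    have he : (fun ξ => (arrivals X D ξ : ℝ)) = ∑ j ∈ D, fun ξ : Word n => (noisy (X j) (ξ j) : ℝ) := by
      ext ξ; simp [arrivals]
    rw [he, IndepFun.variance_sum (fun j _ => memLp_word ε _)]
    · calc _ ≤ ∑ _j ∈ D, (1 : ℝ) := by
            refine Finset.sum_le_sum fun j _ => ?_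
            refine (variance_le_expectation_sq
              (Measurable.of_discrete).aestronglyMeasurable).trans ?_
            calc _ ≤ ∫ _ξ, (1 : ℝ) ∂(noiseLaw ε n) := by
                  refine integral_mono Integrable.of_finite Integrable.of_finite fun ξ => ?_
                  simp only [Pi.pow_apply, noisy]
                  cases xor (X j) (ξ j) <;> simp
              _ = 1 := by simp
        _ = D.card := by simp
    · intro i _ j _ hij
      exact ((iIndepFun_noisy ε X).indepFun hij).comp (φ := fun k : ℕ => (k : ℝ))
        (ψ := fun k : ℕ => (k : ℝ)) Measurable.of_discrete Measurable.of_discrete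
  have h := meas_ge_le_variance_div_sq (memLp_word ε fun ξ => (arrivals X D ξ : ℝ)) hc
  rw [hmean] at h
  rw [measureReal_def]
  refine ENNReal.toReal_le_of_le_ofReal (by positivity) (h.trans (ENNReal.ofReal_le_ofReal ?_))
  gcongr

/-- The part of the event `U + V = y` on which `U` lies in a set. -/
lemma IndepFun.measureReal_add_eq_le {Ω : Type*} [MeasurableSpace Ω] {μ : Measure Ω}
    [IsProbabilityMeasure μ] {U V : Ω → ℕ} (hU : Measurable U) (h : IndepFun U V μ) {B : ℝ}
    (hB : ∀ b, μ.real {ω | V ω = b} ≤ B) (y : ℕ) (A : Set ℕ) :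
    μ.real {ω | U ω + V ω = y ∧ U ω ∈ A} ≤ B * μ.real {ω | U ω ∈ A} := by
  classical
  -- For each value `a ≤ y` of `U` in `A`, independence leaves a factor of at most `B` for the event
  -- `V = y - a`.
  have hsub : {ω | U ω + V ω = y ∧ U ω ∈ A} ⊆
      ⋃ a ∈ (Finset.range (y + 1)).filter (· ∈ A), {ω | U ω = a} ∩ {ω | V ω = y - a} := by
    rintro ω ⟨h1, h2⟩
    simp only [Set.mem_iUnion, Finset.mem_filter, Finset.mem_range]
    exact ⟨U ω, ⟨by omega, h2⟩, rfl, show V ω = y - U ω by omega⟩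
  calc μ.real {ω | U ω + V ω = y ∧ U ω ∈ A}
      ≤ ∑ a ∈ (Finset.range (y + 1)).filter (· ∈ A), μ.real ({ω | U ω = a} ∩ {ω | V ω = y - a}) :=
        (measureReal_mono hsub (measure_ne_top _ _)).trans (measureReal_biUnion_finset_le _ _)
    _ ≤ ∑ a ∈ (Finset.range (y + 1)).filter (· ∈ A), μ.real {ω | U ω = a} * B := by
        refine Finset.sum_le_sum fun a _ => ?_
        have := h.measure_inter_preimage_eq_mul {a} {y - a} (measurableSet_singleton _)
          (measurableSet_singleton _)
        change μ ({ω | U ω = a} ∩ {ω | V ω = y - a}) =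
          μ {ω | U ω = a} * μ {ω | V ω = y - a} at this
        simp only [measureReal_def, this, ENNReal.toReal_mul]
        simp only [← measureReal_def]
        gcongr
        exact hB _
    _ = B * μ.real (⋃ a ∈ (Finset.range (y + 1)).filter (· ∈ A), {ω | U ω = a}) := by
        rw [← Finset.sum_mul, mul_comm, measureReal_biUnion_finset]
        · intro a _ b _ hab
          exact Set.disjoint_left.2 fun ω h1 h2 => hab (h1.symm.trans h2)
        · exact fun a _ => hU (measurableSet_singleton a)
    _ ≤ _ := by
        have hB0 : 0 ≤ B := measureReal_nonneg.trans (hB 0)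
        gcongr
        · simp
        · intro ω hω
          simp only [Set.mem_iUnion, Finset.mem_filter] at hω
          obtain ⟨a, ⟨-, ha⟩, rfl⟩ := hω
          exact ha

/-- The constant of the local limit bound. -/
def localConst (ε : unitInterval) : ℝ := 3 * Real.pi ^ 3 / (2 * ε * (1 - ε))

/-- The local limit bound with quadratic decay away from the mean. -/
lemma measureReal_arrivals_mul_sq_le {ε : unitInterval} (h0 : 0 < ε) (h1 : ε < 1) {n : ℕ}
    (X : Word n) {D : Finset (Fin n)} (hD : 2 ≤ D.card) (y : ℕ) :
    (noiseLaw ε n).real {ξ | arrivals X D ξ = y} *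
      (1 + (y - ∑ j ∈ D, meanBit ε (X j)) ^ 2 / D.card) ≤ 5 * √(localConst ε / D.card) := by
  classical
  set B := √(localConst ε / D.card) with hBdef
  set z : ℝ := y - ∑ j ∈ D, meanBit ε (X j) with hz
  set P := (noiseLaw ε n).real {ξ | arrivals X D ξ = y} with hP
  have hε0 : (0 : ℝ) < ε := h0
  have hε1 : (0 : ℝ) < 1 - ε := by
    have : (ε : ℝ) < 1 := h1
    linarith
  have hpi := Real.pi_pos
  have hN : (0 : ℝ) < D.card := by exact_mod_cast (by omega : 0 < D.card)
  have hB0 : 0 ≤ B := Real.sqrt_nonneg _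
  -- The factor 3 in `localConst` lets the same bound `B` serve `D` and both of its halves; the
  -- extreme case splits 3 as 1 + 2.
  have hsup : ∀ D' : Finset (Fin n), D.card ≤ 3 * D'.card → ∀ b,
      (noiseLaw ε n).real {ξ | arrivals X D' ξ = b} ≤ B := by
    intro D' hD' b
    have hpos : 0 < D'.card := by omega
    refine (measureReal_arrivals_le h0 h1 X (Finset.card_pos.1 hpos) b).trans ?_
    refine Real.sqrt_le_sqrt ?_
    have hpos' : (0 : ℝ) < D'.card := by exact_mod_cast hpos
    have hD'' : (D.card : ℝ) ≤ 3 * D'.card := by exact_mod_cast hD'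
    rw [localConst, div_div, div_le_div_iff₀ (by positivity) (by positivity)]
    have : 0 < Real.pi ^ 3 * (2 * ε * (1 - ε)) := by positivity
    nlinarith
  have hPB : P ≤ B := hsup D (by omega) y
  rcases eq_or_ne z 0 with hz0 | hz0
  · rw [hz0]; simp only [ne_eq, OfNat.ofNat_ne_zero, not_false_eq_true, zero_pow, zero_div,
      add_zero, mul_one]; linarith
  -- If the total is `z` away from its mean, one half is at least `|z| / 2` away from its own.
  -- Chebyshev bounds that event, and the other half must then hit a prescribed value, which costs a
  -- further factor `B`.
  obtain ⟨D₁, hD₁, hc₁⟩ := Finset.exists_subset_card_eq (Nat.div_le_self D.card 2)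
  set D₂ := D \ D₁ with hD₂
  have hc₂ : D₂.card = D.card - D.card / 2 := by
    rw [hD₂, Finset.card_sdiff_of_subset hD₁, hc₁]
  have hdisj : Disjoint D₁ D₂ := Finset.disjoint_sdiff
  have hun : D₁ ∪ D₂ = D := Finset.union_sdiff_of_subset hD₁
  have harr : ∀ ξ, arrivals X D ξ = arrivals X D₁ ξ + arrivals X D₂ ξ := fun ξ => by
    rw [arrivals, ← hun, Finset.sum_union hdisj]; rfl
  have hmean : ∑ j ∈ D, meanBit ε (X j) =
      ∑ j ∈ D₁, meanBit ε (X j) + ∑ j ∈ D₂, meanBit ε (X j) := by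
    rw [← hun, Finset.sum_union hdisj]
  have hzpos : 0 < |z| / 2 := by positivity
  let far : Finset (Fin n) → Set ℕ := fun D' =>
    {a | |z| / 2 ≤ |(a : ℝ) - ∑ j ∈ D', meanBit ε (X j)|}
  have hfar : ∀ D' : Finset (Fin n), (noiseLaw ε n).real {ξ | arrivals X D' ξ ∈ far D'} ≤
      4 * D'.card / z ^ 2 := fun D' => by
    refine (measureReal_abs_arrivals_sub_le ε X D' hzpos).trans (le_of_eq ?_)
    rw [div_pow, sq_abs]; field_simp; norm_num
  have hsub : {ξ | arrivals X D ξ = y} ⊆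
      {ξ | arrivals X D₁ ξ + arrivals X D₂ ξ = y ∧ arrivals X D₁ ξ ∈ far D₁} ∪
      {ξ | arrivals X D₂ ξ + arrivals X D₁ ξ = y ∧ arrivals X D₂ ξ ∈ far D₂} := by
    intro ξ hξ
    have hξ' : arrivals X D₁ ξ + arrivals X D₂ ξ = y := by rw [← harr]; exact hξ
    by_contra hcon
    simp only [Set.mem_union, Set.mem_ofPred_eq, not_or, not_and, far, not_le] at hcon
    have a1 := hcon.1 hξ'
    have a2 := hcon.2 (by omega)
    have : z = ((arrivals X D₁ ξ : ℝ) - ∑ j ∈ D₁, meanBit ε (X j)) +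
        ((arrivals X D₂ ξ : ℝ) - ∑ j ∈ D₂, meanBit ε (X j)) := by
      rw [hz, hmean, ← hξ']; push_cast; ring
    have h3 := abs_add_le ((arrivals X D₁ ξ : ℝ) - ∑ j ∈ D₁, meanBit ε (X j))
      ((arrivals X D₂ ξ : ℝ) - ∑ j ∈ D₂, meanBit ε (X j))
    rw [← this] at h3
    linarith
  have hP2 : P ≤ B * (4 * D₁.card / z ^ 2) + B * (4 * D₂.card / z ^ 2) := by
    refine (measureReal_mono hsub).trans ((measureReal_union_le _ _).trans ?_)
    refine add_le_add ?_ ?_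
    · exact (IndepFun.measureReal_add_eq_le Measurable.of_discrete (indepFun_arrivals ε X hdisj)
        (hsup D₂ (by omega)) y _).trans (by gcongr; exact hfar D₁)
    · exact (IndepFun.measureReal_add_eq_le Measurable.of_discrete
        (indepFun_arrivals ε X hdisj.symm) (hsup D₁ (by omega)) y _).trans (by gcongr; exact hfar D₂)
  have hcard : (D₁.card : ℝ) + D₂.card = D.card := by
    rw [← hun, Finset.card_union_of_disjoint hdisj]; push_cast; ring
  have hz2 : 0 < z ^ 2 := by positivity
  have hP3 : P * (z ^ 2 / D.card) ≤ 4 * B := by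
    have : B * (4 * D₁.card / z ^ 2) + B * (4 * D₂.card / z ^ 2) = 4 * B * (D.card / z ^ 2) := by
      rw [← hcard]; ring
    rw [this] at hP2
    calc P * (z ^ 2 / D.card) ≤ 4 * B * (D.card / z ^ 2) * (z ^ 2 / D.card) := by gcongr
      _ = 4 * B := by field_simp
  rw [mul_add]; linarith

/-! ### Quantization of the cumulative mean by delays -/

/-- A cumulative quantity that grows by at least `p` and at most `1` in every step. -/
structure Cumulative (p : ℝ) (S : ℕ → ℝ) : Prop where
  zero : S 0 = 0
  le_step : ∀ k, S k + p ≤ S (k + 1)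
  step_le : ∀ k, S (k + 1) ≤ S k + 1

/-- The index of the quantum of size `q` in which the cumulative quantity lies. -/
def level (S : ℕ → ℝ) (q : ℝ) (k : ℕ) : ℕ := ⌊S k / q⌋₊

namespace Cumulative

variable {p q : ℝ} {S : ℕ → ℝ}

lemma monotone (hS : Cumulative p S) (hp : 0 < p) : Monotone S :=
  monotone_nat_of_le_succ fun k => by linarith [hS.le_step k]

lemma le_add (hS : Cumulative p S) (k l : ℕ) : S k + p * l ≤ S (k + l) := by
  induction l with
  | zero => simp
  | succ l ih => have := hS.le_step (k + l); push_cast; rw [← add_assoc]; linarith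

lemma add_le (hS : Cumulative p S) (k l : ℕ) : S (k + l) ≤ S k + l := by
  induction l with
  | zero => simp
  | succ l ih => have := hS.step_le (k + l); push_cast; rw [← add_assoc]; linarith

lemma nonneg (hS : Cumulative p S) (hp : 0 < p) (k : ℕ) : 0 ≤ S k :=
  hS.zero ▸ hS.monotone hp k.zero_le

lemma level_mono (hS : Cumulative p S) (hp : 0 < p) (hq : 0 < q) : Monotone (level S q) :=
  fun _ _ h => Nat.floor_mono (div_le_div_of_nonneg_right (hS.monotone hp h) hq.le)

lemma le_level_iff (hS : Cumulative p S) (hp : 0 < p) (hq : 0 < q) {v k : ℕ} :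
    v ≤ level S q k ↔ v * q ≤ S k := by
  rw [level, Nat.le_floor_iff (div_nonneg (hS.nonneg hp k) hq.le), le_div_iff₀ hq]

/-- The quantum `p * L` is the least growth over `L` steps, so every interval completes at least one
quantum and no symbol has to be held back further than the next interval. -/
lemma level_lt_level_add (hS : Cumulative p S) (hp : 0 < p) {L : ℕ} (hL : 0 < L) (k : ℕ) :
    level S (p * L) k < level S (p * L) (k + L) := by
  have hq : 0 < p * L := by positivity
  rw [← Nat.succ_le_iff, hS.le_level_iff hp hq]
  have h1 := (hS.le_level_iff hp hq (k := k)).1 le_rfl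
  have h2 := hS.le_add k L
  push_cast; linarith

lemma level_add_le (hS : Cumulative p S) (hp : 0 < p) {L : ℕ} (hL : 0 < L) (k : ℕ) :
    level S (p * L) (k + L) ≤ level S (p * L) k + ⌈1 / p⌉₊ := by
  have hq : 0 < p * L := by positivity
  rw [level, level, ← Nat.floor_add_natCast (div_nonneg (hS.nonneg hp k) hq.le)]
  refine Nat.floor_mono ?_
  have hL' : (0 : ℝ) < L := by exact_mod_cast hL
  calc S (k + L) / (p * L) ≤ (S k + L) / (p * L) := by gcongr; exact hS.add_le k L
    _ = S k / (p * L) + 1 / p := by field_simp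
    _ ≤ _ := by gcongr; exact Nat.le_ceil _

/-- At the first index of level at least `v`, the overshoot is at most one step, hence at most 1. -/
lemma exists_cut (hS : Cumulative p S) (hp : 0 < p) (hq : 0 < q) {v k₀ : ℕ}
    (h : v ≤ level S q k₀) :
    ∃ k ≤ k₀, (∀ j, v ≤ level S q j ↔ k ≤ j) ∧ v * q ≤ S k ∧ S k ≤ v * q + 1 := by
  classical
  have hex : ∃ k, v ≤ level S q k := ⟨k₀, h⟩
  refine ⟨Nat.find hex, Nat.find_min' hex h, fun j => ⟨fun hj => Nat.find_min' hex hj,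
    fun hj => (Nat.find_spec hex).trans (hS.level_mono hp hq hj)⟩,
    (hS.le_level_iff hp hq).1 (Nat.find_spec hex), ?_⟩
  rcases hk : Nat.find hex with _ | k
  · rw [hS.zero]; positivity
  · have h1 := Nat.find_min hex (m := k) (by omega)
    rw [hS.le_level_iff hp hq, not_le] at h1
    linarith [hS.step_le k]

end Cumulative

/-- The delay that collects the symbols at multiples of `L`, and holds those of the last,
incomplete, quantum back until the next multiple. -/
def quantizingDelay (S : ℕ → ℝ) (q : ℝ) (L j : ℕ) : ℕ :=
  if level S q j < level S q (L * (j / L) + L) then L * (j / L) + (L - 1) - j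
  else L * (j / L) + (2 * L - 1) - j

lemma add_quantizingDelay (S : ℕ → ℝ) (q : ℝ) {L : ℕ} (hL : 0 < L) (j : ℕ) :
    j + quantizingDelay S q L j = if level S q j < level S q (L * (j / L) + L) then
      L * (j / L + 1) - 1 else L * (j / L + 2) - 1 := by
  have h1 := Nat.lt_mul_div_succ j hL
  rw [mul_add] at h1
  rw [quantizingDelay]
  split_ifs <;> rw [mul_add] <;> omega

lemma quantizingDelay_le (S : ℕ → ℝ) (q : ℝ) (L j : ℕ) :
    quantizingDelay S q L j ≤ 2 * L - 1 := by
  have := Nat.mul_div_le j L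
  rw [quantizingDelay]
  split_ifs <;> omega

/-- Levels strictly increase along the multiples of `L`, and a symbol held back has exactly the
level at which the next batch starts. Each batch is therefore a run of consecutive symbols between
two cuts. -/
lemma add_quantizingDelay_eq_iff {p : ℝ} {S : ℕ → ℝ} (hS : Cumulative p S) (hp : 0 < p) {L : ℕ}
    (hL : 0 < L) (j t : ℕ) : j + quantizingDelay S (p * L) L j = L * (t + 1) - 1 ↔
      level S (p * L) (L * t) ≤ level S (p * L) j ∧
        level S (p * L) j < level S (p * L) (L * (t + 1)) := by
  have hq : 0 < p * L := by positivity
  have hmono := hS.level_mono hp hq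
  set f := level S (p * L) with hf
  have hstep : ∀ t, f (L * t) < f (L * (t + 1)) := fun t => by
    rw [mul_add, mul_one]; exact hS.level_lt_level_add hp hL _
  have hcancel : ∀ a b : ℕ, 0 < a → 0 < b → (L * a - 1 = L * b - 1 ↔ a = b) := by
    intro a b ha hb
    have h1 : 0 < L * a := by positivity
    have h2 : 0 < L * b := by positivity
    exact ⟨fun h => Nat.eq_of_mul_eq_mul_left hL (by omega), fun h => by rw [h]⟩
  set b := j / L with hb
  have hbj : L * b ≤ j := Nat.mul_div_le j L
  have hjb : j < L * (b + 1) := Nat.lt_mul_div_succ j hL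
  have h1 := hmono hbj
  have h2 := hmono hjb.le
  have hstrict : StrictMono fun t => f (L * t) := strictMono_nat_of_lt_succ hstep
  rw [add_quantizingDelay _ _ hL, ← hf, ← hb, show L * b + L = L * (b + 1) by ring]
  split_ifs with h
  · rw [hcancel _ _ (Nat.succ_pos _) (Nat.succ_pos _)]
    constructor
    · intro e
      obtain rfl : b = t := by omega
      exact ⟨h1, h⟩
    · rintro ⟨h3, h4⟩
      have h5 : t < b + 1 := hstrict.lt_iff_lt.1 (h3.trans_lt h)
      have h6 : b < t + 1 := hstrict.lt_iff_lt.1 (h1.trans_lt h4)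
      omega
  · have h' : f j = f (L * (b + 1)) := le_antisymm h2 (not_lt.1 h)
    rw [hcancel _ _ (Nat.succ_pos _) (Nat.succ_pos _), h']
    constructor
    · intro e
      obtain rfl : b + 1 = t := by omega
      exact ⟨le_rfl, hstep _⟩
    · rintro ⟨h3, h4⟩
      have h5 : t ≤ b + 1 := hstrict.le_iff_le.1 h3
      have h6 : b + 1 < t + 1 := hstrict.lt_iff_lt.1 h4
      omega

lemma dvd_add_quantizingDelay (S : ℕ → ℝ) (q : ℝ) {L : ℕ} (hL : 0 < L) (j : ℕ) :
    L ∣ j + quantizingDelay S q L j + 1 := by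
  rw [add_quantizingDelay _ _ hL]
  split_ifs
  · exact ⟨j / L + 1, Nat.sub_add_cancel (Nat.mul_pos hL (Nat.succ_pos _))⟩
  · exact ⟨j / L + 2, Nat.sub_add_cancel (Nat.mul_pos hL (Nat.succ_pos _))⟩

/-- The mean number of ones received from the first `k` symbols; the codeword is continued by
zeros. -/
def cumulativeMean (ε : unitInterval) {n : ℕ} (X : Word n) (k : ℕ) : ℝ :=
  ∑ i ∈ Finset.range k, if h : i < n then meanBit ε (X ⟨i, h⟩) else ε

lemma le_meanBit (ε : unitInterval) (x : Bool) : min (ε : ℝ) (1 - ε) ≤ meanBit ε x := by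
  cases x <;> simp [meanBit]

lemma meanBit_le_one (ε : unitInterval) (x : Bool) : meanBit ε x ≤ 1 := by
  cases x <;> simp [meanBit, ε.2.1, ε.2.2]

lemma cumulative_cumulativeMean (ε : unitInterval) {n : ℕ} (X : Word n) :
    Cumulative (min (ε : ℝ) (1 - ε)) (cumulativeMean ε X) where
  zero := by simp [cumulativeMean]
  le_step k := by
    rw [cumulativeMean, cumulativeMean, Finset.sum_range_succ]
    gcongr
    split_ifs
    · exact le_meanBit _ _
    · exact min_le_left _ _
  step_le k := by
    rw [cumulativeMean, cumulativeMean, Finset.sum_range_succ]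
    gcongr
    split_ifs
    · exact meanBit_le_one _ _
    · exact ε.2.2

lemma sum_meanBit_eq (ε : unitInterval) {n : ℕ} (X : Word n) {k l : ℕ} (hkl : k ≤ l) (hl : l ≤ n) :
    ∑ j ∈ Finset.univ.filter (fun j : Fin n => k ≤ (j : ℕ) ∧ (j : ℕ) < l), meanBit ε (X j) =
      cumulativeMean ε X l - cumulativeMean ε X k := by
  rw [cumulativeMean, cumulativeMean, ← Finset.sum_Ico_eq_sub _ hkl]
  refine Finset.sum_bij (fun j _ => (j : ℕ)) ?_ (fun a _ b _ h => Fin.ext h) ?_ ?_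
  · intro j hj; simpa using hj
  · intro i hi
    have := Finset.mem_Ico.1 hi
    exact ⟨⟨i, by omega⟩, by simpa using this, rfl⟩
  · intro j _; simp

/-! ### Laws of batches and the channels with random noise -/

/-- The width constant in the bound for the law of a quantized batch of symbols. -/
def batchConst (ε : unitInterval) : ℝ := 20 * √(2 * localConst ε / min (ε : ℝ) (1 - ε))

/-- The bound for the law of a batch of symbols, of expected weight `w` quanta. -/
def batchBound (ε : unitInterval) (L w y : ℕ) : ℝ :=
  batchConst ε / √L * (1 / (1 + ((y - w * (min (ε : ℝ) (1 - ε) * L)) / √L) ^ 2))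

lemma batchBound_nonneg (ε : unitInterval) (L w y : ℕ) : 0 ≤ batchBound ε L w y := by
  unfold batchBound batchConst; positivity

/-- This removes the codeword from the local limit bound except for the number `w` of quanta: the
mean is within 1 of `w` quanta, and the size of the batch lies between `p L / 2` and `2 L`, where `p
= min ε (1 - ε)`. -/
lemma measureReal_batch_le {ε : unitInterval} (h0 : 0 < ε) (h1 : ε < 1) {n L w : ℕ} (X : Word n)
    {D : Finset (Fin n)} (hL : 4 ≤ min (ε : ℝ) (1 - ε) * L) (hw : 1 ≤ w) (hcard : D.card ≤ 2 * L)
    (hmean : |∑ j ∈ D, meanBit ε (X j) - w * (min (ε : ℝ) (1 - ε) * L)| ≤ 1) (y : ℕ) :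
    (noiseLaw ε n).real {ξ | arrivals X D ξ = y} ≤ batchBound ε L w y := by
  have hε0 : (0 : ℝ) < ε := h0
  have hε1 : (0 : ℝ) < 1 - ε := by
    have : (ε : ℝ) < 1 := h1
    linarith
  set p := min (ε : ℝ) (1 - ε) with hp
  have hp0 : 0 < p := lt_min hε0 hε1
  set a := (w : ℝ) * (p * L) with ha
  set μ := ∑ j ∈ D, meanBit ε (X j) with hμ
  have hμN : μ ≤ D.card := by
    calc μ ≤ ∑ _j ∈ D, (1 : ℝ) := Finset.sum_le_sum fun j _ => meanBit_le_one _ _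
      _ = D.card := by simp
  obtain ⟨hm1, hm2⟩ := abs_le.1 hmean
  have hLpos : (0 : ℝ) < L := by
    by_contra! h
    nlinarith
  have hwL : p * L ≤ a := by
    have : (1 : ℝ) ≤ w := by exact_mod_cast hw
    rw [ha]; nlinarith
  have hN3 : (3 : ℝ) ≤ D.card := by linarith
  have hN : p * L / 2 ≤ (D.card : ℝ) := by linarith
  have hN0 : (0 : ℝ) < D.card := by linarith
  have hN2 : (D.card : ℝ) ≤ 2 * L := by exact_mod_cast hcard
  have hD2 : 2 ≤ D.card := by
    have : (2 : ℝ) ≤ D.card := by linarith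
    exact_mod_cast this
  have key := measureReal_arrivals_mul_sq_le h0 h1 X hD2 y
  set P := (noiseLaw ε n).real {ξ | arrivals X D ξ = y} with hP
  have hP0 : 0 ≤ P := measureReal_nonneg
  rw [← hμ] at key
  have hs : √(L : ℝ) ^ 2 = L := Real.sq_sqrt hLpos.le
  have hs0 : 0 < √(L : ℝ) := Real.sqrt_pos.2 hLpos
  -- Recentring at `a` and rescaling to `L` costs a factor 4, which with the 5 of the local bound
  -- gives the 20 in `batchConst`.
  have hquad : 1 + ((y - a) / √L) ^ 2 ≤ 4 * (1 + (y - μ) ^ 2 / D.card) := by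
    rw [div_pow, hs]
    have e1 : ((y : ℝ) - a) ^ 2 ≤ 2 * (y - μ) ^ 2 + 2 := by
      have : (μ - a) ^ 2 ≤ 1 := by rw [sq_le_one_iff_abs_le_one]; exact hmean
      nlinarith [sq_nonneg ((y - μ) - (μ - a))]
    have e2 : ((y : ℝ) - a) ^ 2 / L ≤ (2 * (y - μ) ^ 2 + 2) / L := by gcongr
    have e3 : (2 * ((y : ℝ) - μ) ^ 2 + 2) / L = 2 * ((y - μ) ^ 2 / L) + 2 / L := by ring
    have e4 : ((y : ℝ) - μ) ^ 2 / L ≤ 2 * ((y - μ) ^ 2 / D.card) := by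
      rw [← mul_div_assoc, div_le_div_iff₀ hLpos hN0]
      nlinarith [sq_nonneg ((y : ℝ) - μ)]
    have e5 : 2 / (L : ℝ) ≤ 3 := by
      rw [div_le_iff₀ hLpos]
      have : (2 : ℝ) ≤ 2 * L := by linarith
      linarith
    linarith
  have hsqrt : √(localConst ε / D.card) ≤ √(2 * localConst ε / p) / √L := by
    have hc : 0 ≤ localConst ε := by
      unfold localConst
      have := Real.pi_pos
      positivity
    rw [← Real.sqrt_div (by positivity)]
    refine Real.sqrt_le_sqrt ?_
    rw [div_div, div_le_div_iff₀ hN0 (by positivity)]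
    nlinarith
  have hfin : P * (1 + ((y - a) / √L) ^ 2) ≤ batchConst ε / √L := by
    calc P * (1 + ((y - a) / √L) ^ 2) ≤ P * (4 * (1 + (y - μ) ^ 2 / D.card)) := by gcongr
      _ = 4 * (P * (1 + (y - μ) ^ 2 / D.card)) := by ring
      _ ≤ 4 * (5 * (√(2 * localConst ε / p) / √L)) := by linarith
      _ = batchConst ε / √L := by rw [batchConst, ← hp]; ring
  rw [batchBound, ← hp, ← ha, mul_one_div, le_div_iff₀ (by positivity)]
  exact hfin

/-- The sum, over the possible numbers `w ≤ W` of quanta, of the bounds for the law of a batch. -/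
def batchMeasure (ε : unitInterval) (L W n : ℕ) : Measure ℕ :=
  ∑ w ∈ Finset.range (W + 1), ∑ y ∈ Finset.range (n + 1),
    ENNReal.ofReal (batchBound ε L w y) • Measure.dirac y

/-- The height `1 / √L` and the width `√L` cancel, so the bound does not depend on the grid. -/
lemma batchMeasure_univ_le (ε : unitInterval) {L : ℕ} (hL : 0 < L) (W n : ℕ) :
    batchMeasure ε L W n Set.univ ≤
      ENNReal.ofReal ((W + 1) * (3 * Real.pi * batchConst ε)) := by
  have hs : 1 ≤ √(L : ℝ) := by
    rw [Real.one_le_sqrt]; exact_mod_cast hL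
  have hc : 0 ≤ batchConst ε := by unfold batchConst; positivity
  simp only [batchMeasure, Measure.coe_finsetSum, Finset.sum_apply, Measure.smul_apply,
    measure_univ, smul_eq_mul, mul_one]
  have hw : ∀ w : ℕ, ∑ y ∈ Finset.range (n + 1), ENNReal.ofReal (batchBound ε L w y) ≤
      ENNReal.ofReal (3 * Real.pi * batchConst ε) := by
    intro w
    rw [← ENNReal.ofReal_sum_of_nonneg fun y _ => batchBound_nonneg ε L w y]
    refine ENNReal.ofReal_le_ofReal ?_
    simp only [batchBound]
    rw [← Finset.mul_sum]
    calc _ ≤ batchConst ε / √L * (3 * Real.pi * √L) := by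
          gcongr
          exact sum_lorentzian_le hs _ _
      _ = 3 * Real.pi * batchConst ε := by field_simp
  calc _ ≤ ∑ _w ∈ Finset.range (W + 1), ENNReal.ofReal (3 * Real.pi * batchConst ε) :=
        Finset.sum_le_sum fun w _ => hw w
    _ = _ := by
        rw [Finset.sum_const, Finset.card_range, nsmul_eq_mul,
          show (W : ℝ) + 1 = ((W + 1 : ℕ) : ℝ) by push_cast; rfl,
          ENNReal.ofReal_mul (p := ((W + 1 : ℕ) : ℝ)) (Nat.cast_nonneg _), ENNReal.ofReal_natCast]

lemma le_batchMeasure (ε : unitInterval) {L W n w y : ℕ} (hw : w ≤ W) (hy : y ≤ n) :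
    ENNReal.ofReal (batchBound ε L w y) ≤ batchMeasure ε L W n {y} := by
  simp only [batchMeasure, Measure.coe_finsetSum, Finset.sum_apply, Measure.smul_apply,
    smul_eq_mul]
  refine le_trans ?_ (Finset.single_le_sum (f := fun w => ∑ y' ∈ Finset.range (n + 1),
    ENNReal.ofReal (batchBound ε L w y') * (Measure.dirac y' : Measure ℕ) {y}) (by simp)
    (Finset.mem_range.2 (Nat.lt_succ_of_le hw)))
  refine le_trans ?_ (Finset.single_le_sum (f := fun y' =>
    ENNReal.ofReal (batchBound ε L w y') * (Measure.dirac y' : Measure ℕ) {y}) (by simp)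
    (Finset.mem_range.2 (Nat.lt_succ_of_le hy)))
  simp

lemma arrivals_le {n : ℕ} (X : Word n) (D : Finset (Fin n)) (ξ : Word n) : arrivals X D ξ ≤ n := by
  calc arrivals X D ξ ≤ ∑ _j ∈ D, 1 := by
        refine Finset.sum_le_sum fun j _ => ?_
        unfold noisy
        cases xor (X j) (ξ j) <;> simp
    _ ≤ n := by simpa using D.card_le_univ

theorem finiteCapacity_advDelayRandNoise {ε : unitInterval} (h0 : 0 < ε) (h1 : ε < 1) :
    FiniteCapacity (advDelayRandNoise ε) := by
  classical
  have hε0 : (0 : ℝ) < ε := h0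
  have hε1 : (0 : ℝ) < 1 - ε := by
    have : (ε : ℝ) < 1 := h1
    linarith
  set p := min (ε : ℝ) (1 - ε) with hp
  have hp0 : 0 < p := lt_min hε0 hε1
  set W := ⌈1 / p⌉₊ with hW
  obtain ⟨K, hK⟩ := pow_unbounded_of_one_lt ((W + 1) * (3 * Real.pi * batchConst ε))
    (one_lt_two : (1 : ℝ) < 2)
  -- The threshold on `M` ensures `p L ≥ 4` for `L = M / 2`, and `3 T` intervals of length `L` cover
  -- the time since `M ≤ 3 L`.
  refine FiniteCapacity.of_dominated (fun M n => ?_) ?_ (K * 3) (2 * (⌈4 / p⌉₊ + 1)) ?_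
  · exact ⟨fun X => _, fun _ _ => 0, by simp, fun X => rfl⟩
  · rintro M n V ⟨d, -, h⟩ X
    rw [h]; exact Measure.isProbabilityMeasure_map Measurable.of_discrete.aemeasurable
  intro M T hT hM
  -- Half a unit, because the quantizing delay can reach `2 * L - 1`.
  set L := (M : ℕ) / 2 with hLdef
  have hLge : ⌈4 / p⌉₊ + 1 ≤ L := by omega
  have hL : 0 < L := by omega
  have hpL : 4 ≤ p * L := by
    have h2 : ((⌈4 / p⌉₊ + 1 : ℕ) : ℝ) ≤ L := by exact_mod_cast hLge
    have h3 := Nat.le_ceil (4 / p)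
    push_cast at h2
    have h4 : 4 / p ≤ L := by linarith
    rw [div_le_iff₀ hp0] at h4; linarith
  have hq : 0 < p * L := by linarith
  set n := (M : ℕ) * T with hn
  let S : Word n → ℕ → ℝ := fun X => cumulativeMean ε X
  have hS : ∀ X, Cumulative p (S X) := fun X => cumulative_cumulativeMean ε X
  let d : Word n → Counts n := fun X j => quantizingDelay (S X) (p * L) L j
  let ρ : Fin n → Measure ℕ := fun i => if L ∣ (i : ℕ) + 1 then batchMeasure ε L W n
    else Measure.dirac 0
  have hmass : batchMeasure ε L W n Set.univ ≤ 2 ^ K := by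
    refine (batchMeasure_univ_le ε hL W n).trans ((ENNReal.ofReal_le_ofReal hK.le).trans ?_)
    rw [ENNReal.ofReal_pow (by norm_num)]; simp
  have hρfin : ∀ i, IsFiniteMeasure (ρ i) := by
    intro i
    simp only [ρ]
    split_ifs
    · exact ⟨hmass.trans_lt (by simp)⟩
    · infer_instance
  refine ⟨_, ⟨d, fun X j => ?_, fun X => rfl⟩, Measure.pi ρ, ?_, fun X s => ?_⟩
  · have := quantizingDelay_le (S X) (p * L) L j
    change quantizingDelay (S X) (p * L) L j ≤ M
    omega
  · rw [mul_assoc]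
    refine pi_univ_le_of_ticks hL ?_ (fun i hi => ?_) fun i hi => ?_
    · rw [hn]
      calc (M : ℕ) * T ≤ (L * 3) * T := Nat.mul_le_mul_right _ (by omega)
        _ = L * (3 * T) := by ring
    · simp [ρ, hi]
    · simpa [ρ, hi] using hmass
  · refine (measure_le_of_singleton_le (fun y => ?_) s).trans le_self_add
    set D : Fin n → Finset (Fin n) := fun i =>
      Finset.univ.filter fun j : Fin n => (j : ℕ) + d X j = i with hD
    rw [Measure.map_apply Measurable.of_discrete (measurableSet_singleton _), Measure.pi_singleton]
    have hset : (fun ξ => received X ξ (d X)) ⁻¹' {y} = {ξ | ∀ i, arrivals X (D i) ξ = y i} := by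
      ext ξ
      simp only [Set.mem_preimage, Set.mem_singleton_iff, funext_iff, Set.mem_ofPred_eq]
      rfl
    rw [hset, measure_arrivals_eq_prod]
    swap
    · intro i i' hii
      refine Finset.disjoint_left.2 fun j hj hj' => hii ?_
      simp only [hD, Finset.mem_filter] at hj hj'
      exact Fin.ext (hj.2.symm.trans hj'.2)
    refine Finset.prod_le_prod' fun i _ => ?_
    by_cases hi : L ∣ (i : ℕ) + 1
    · simp only [ρ, hi, if_true]
      by_cases hy : y i ≤ n
      swap
      · rw [show {ξ | arrivals X (D i) ξ = y i} = ∅ from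
          Set.eq_empty_of_forall_notMem fun ξ (hξ : _ = _) => hy (hξ ▸ arrivals_le X (D i) ξ)]
        simp
      obtain ⟨t, ht⟩ := hi
      have ht0 : 0 < t := Nat.pos_of_ne_zero (by rintro rfl; simp at ht)
      obtain ⟨t, rfl⟩ : ∃ t', t = t' + 1 := ⟨t - 1, by omega⟩
      set v := level (S X) (p * L) (L * t) with hv
      set v' := level (S X) (p * L) (L * (t + 1)) with hv'
      have hvv : v < v' := by
        rw [hv', mul_add, mul_one]; exact (hS X).level_lt_level_add hp0 hL _
      have hvW : v' ≤ v + W := by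
        rw [hv', mul_add, mul_one]; exact (hS X).level_add_le hp0 hL _
      -- The batch is the run between the cuts of levels `v` and `v'`. Each cut overshoots by at
      -- most 1, so the mean is within 1 of `v' - v` quanta.
      obtain ⟨k, -, hkiff, hk1, hk2⟩ := (hS X).exists_cut hp0 hq (le_refl v)
      obtain ⟨k', hk', hkiff', hk1', hk2'⟩ := (hS X).exists_cut hp0 hq (le_refl v')
      have hkk : k ≤ k' := (hkiff k').1 (hvv.le.trans ((hkiff' k').2 le_rfl))
      have hDi : D i = Finset.univ.filter fun j : Fin n => k ≤ (j : ℕ) ∧ (j : ℕ) < k' := by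
        refine Finset.filter_congr fun j _ => ?_
        have e : (i : ℕ) = L * (t + 1) - 1 := by omega
        rw [e]
        change (j : ℕ) + quantizingDelay (S X) (p * L) L j = _ ↔ _
        rw [add_quantizingDelay_eq_iff (hS X) hp0 hL, ← hv, ← hv', hkiff, ← not_le, hkiff', not_le]
      have hmean : |∑ j ∈ D i, meanBit ε (X j) - (v' - v : ℕ) * (p * L)| ≤ 1 := by
        rw [hDi, sum_meanBit_eq ε X hkk (hk'.trans (by have := i.2; omega)), Nat.cast_sub hvv.le]
        change |S X k' - S X k - _| ≤ 1
        rw [abs_le]; constructor <;> linarith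
      have hcard : (D i).card ≤ 2 * L := by
        calc (D i).card ≤ (Finset.Icc ((i : ℕ) + 1 - 2 * L) i).card := by
              refine Finset.card_le_card_of_injOn (fun j => (j : ℕ)) ?_ (fun a _ b _ h => Fin.ext h)
              intro j hj
              have h3 : (j : ℕ) + quantizingDelay (S X) (p * L) L j = i :=
                (Finset.mem_filter.1 hj).2
              have h4 := quantizingDelay_le (S X) (p * L) L j
              simp only [Finset.coe_Icc, Set.mem_Icc]
              omega
          _ ≤ 2 * L := by rw [Nat.card_Icc]; omega
      have hle := measureReal_batch_le h0 h1 X hpL (by omega) hcard hmean (y i)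
      refine le_trans ?_ (le_batchMeasure ε (w := v' - v) (by omega) hy)
      rw [← ofReal_measureReal]
      exact ENNReal.ofReal_le_ofReal hle
    · have hempty : D i = ∅ := by
        refine Finset.filter_eq_empty_iff.2 fun j _ h => hi ?_
        rw [← h]; exact dvd_add_quantizingDelay _ _ hL j
      simp only [ρ, hi, if_false, hempty, arrivals, Finset.sum_empty]
      by_cases hy : y i = 0
      · simp [hy]
      · simp [Ne.symm hy]

/-- An adversary who sees the noise may ignore it. -/
theorem finiteCapacity_randNoiseAdvDelay {ε : unitInterval} (h0 : 0 < ε) (h1 : ε < 1) :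
    FiniteCapacity (randNoiseAdvDelay ε) :=
  FiniteCapacity.mono (𝒞 := advDelayRandNoise ε)
    (fun _ _ _ ⟨d, hd, h⟩ => ⟨fun X _ => d X, fun X _ => hd X, h⟩)
    (finiteCapacity_advDelayRandNoise h0 h1)

/-! ### Memorylessness and resampling of the departure position -/

lemma geometric_add {p : unitInterval} (hp : p ≠ 0) (c r : ℕ) :
    geometricMeasure p {c + r} = ENNReal.ofReal ((1 - p) ^ c) * geometricMeasure p {r} := by
  have h : (0 : ℝ) ≤ 1 - p := by linarith [p.2.2]
  rw [geometricMeasure_singleton hp, geometricMeasure_singleton hp,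
    ← ENNReal.ofReal_mul (by positivity), pow_add, mul_assoc]

lemma measure_Ico_eq_sum (μ : Measure ℕ) (c B : ℕ) :
    μ (Set.Ico c (c + B)) = ∑ r ∈ Finset.range B, μ {c + r} := by
  rw [← measure_biUnion_finset]
  · congr 1
    ext d
    simp only [Set.mem_Ico, Set.mem_iUnion, Finset.mem_range, Set.mem_singleton_iff, exists_prop]
    exact ⟨fun h => ⟨d - c, by omega, by omega⟩, by rintro ⟨r, hr, rfl⟩; omega⟩
  · intro a _ b _ hab
    simpa using hab
  · exact fun _ _ => measurableSet_singleton _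

/-- Memorylessness of the geometric law. -/
lemma geometric_Ico {p : unitInterval} (hp : p ≠ 0) (c B : ℕ) :
    geometricMeasure p (Set.Ico c (c + B)) =
      ENNReal.ofReal ((1 - p) ^ c) * geometricMeasure p (Set.Iio B) := by
  have h : Set.Iio B = Set.Ico 0 (0 + B) := by ext; simp
  rw [h, measure_Ico_eq_sum, measure_Ico_eq_sum, Finset.mul_sum]
  exact Finset.sum_congr rfl fun r _ => by rw [geometric_add hp, zero_add]

/-- The law of the position within an interval of length `B` at which a symbol leaves, given that
it leaves within that interval. -/
def positionLaw (p : unitInterval) (B : ℕ) : Measure ℕ := cond (geometricMeasure p) (Set.Iio B)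

lemma geometric_Iio_ne_zero {p : unitInterval} (hp : p ≠ 0) {B : ℕ} (hB : 0 < B) :
    geometricMeasure p (Set.Iio B) ≠ 0 := by
  have h1 : (0 : ℝ) < p := lt_of_le_of_ne p.2.1 fun h => hp (Subtype.ext h.symm)
  have h2 : geometricMeasure p {0} ≤ geometricMeasure p (Set.Iio B) :=
    measure_mono (by simpa using hB)
  rw [geometricMeasure_singleton hp] at h2
  simp only [pow_zero, one_mul] at h2
  exact (lt_of_lt_of_le (ENNReal.ofReal_pos.2 h1) h2).ne'

lemma isProbabilityMeasure_positionLaw {p : unitInterval} (hp : p ≠ 0) {B : ℕ} (hB : 0 < B) :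
    IsProbabilityMeasure (positionLaw p B) :=
  cond_isProbabilityMeasure (geometric_Iio_ne_zero hp hB)

/-- Move the departure of the symbol `j` with delay `d` to the position `r` within its interval of
length `B`, unless the symbol leaves in the interval in which it was sent. -/
def relocate (B j d r : ℕ) : ℕ :=
  if (j + d) / B = j / B then d else B * ((j + d) / B) + r % B - j

lemma add_relocate {B j d : ℕ} (hB : 0 < B) (r : ℕ) (h : (j + d) / B ≠ j / B) :
    j + relocate B j d r = B * ((j + d) / B) + r % B := by
  have h1 : j / B + 1 ≤ (j + d) / B :=
    lt_of_le_of_ne (Nat.div_le_div_right (Nat.le_add_right _ _)) h.symm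
  have h2 := Nat.mul_le_mul_left B h1
  have h3 := Nat.lt_mul_div_succ j hB
  rw [relocate, if_neg h]
  omega

lemma add_relocate_div {B j d : ℕ} (hB : 0 < B) (r : ℕ) :
    (j + relocate B j d r) / B = (j + d) / B := by
  by_cases h : (j + d) / B = j / B
  · rw [relocate, if_pos h]
  · rw [add_relocate hB r h, Nat.mul_add_div hB, Nat.div_eq_of_lt (Nat.mod_lt _ hB), add_zero]

lemma relocate_eq_iff_of_eq {B j e : ℕ} (hB : 0 < B) (he : (j + e) / B = j / B) (d r : ℕ) :
    relocate B j d r = e ↔ d = e := by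
  constructor
  · rintro rfl
    rw [add_relocate_div hB] at he
    rw [relocate, if_pos he]
  · rintro rfl
    rw [relocate, if_pos he]

lemma relocate_eq_iff_of_ne {B j e : ℕ} (hB : 0 < B) (he : (j + e) / B ≠ j / B) (d r : ℕ) :
    relocate B j d r = e ↔ (j + d) / B = (j + e) / B ∧ r % B = (j + e) % B := by
  constructor
  · rintro rfl
    rw [add_relocate_div hB] at he ⊢
    refine ⟨rfl, ?_⟩
    rw [add_relocate hB r he, Nat.mul_add_mod, Nat.mod_mod]
  · rintro ⟨h1, h2⟩
    have h3 := add_relocate (d := d) hB r (h1 ▸ he)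
    rw [h1, h2, Nat.div_add_mod] at h3
    omega

/-- Resampling the position of departure within an interval does not change the law of a delay. -/
lemma map_relocate {p : unitInterval} (hp : p ≠ 0) {B : ℕ} (hB : 0 < B) (j : ℕ) :
    ((geometricMeasure p).prod (positionLaw p B)).map (fun z => relocate B j z.1 z.2) =
      geometricMeasure p := by
  have := isProbabilityMeasure_positionLaw hp hB
  refine Measure.ext_of_singleton fun e => ?_
  rw [Measure.map_apply Measurable.of_discrete (measurableSet_singleton _)]
  -- Within its own interval a symbol can leave only from its own position on, so the position law
  -- does not apply there and such delays are left alone.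
  by_cases he : (j + e) / B = j / B
  · have h1 : (fun z : ℕ × ℕ => relocate B j z.1 z.2) ⁻¹' {e} = {e} ×ˢ Set.univ := by
      ext ⟨d, r⟩
      simp [relocate_eq_iff_of_eq hB he]
    rw [h1, Measure.prod_prod, measure_univ, mul_one]
  · have h1 : (fun z : ℕ × ℕ => relocate B j z.1 z.2) ⁻¹' {e} =
        {d | (j + d) / B = (j + e) / B} ×ˢ {r | r % B = (j + e) % B} := by
      ext ⟨d, r⟩
      simp [relocate_eq_iff_of_ne hB he]
    have h2 : j / B + 1 ≤ (j + e) / B :=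
      lt_of_le_of_ne (Nat.div_le_div_right (Nat.le_add_right _ _)) (Ne.symm he)
    have h3 := Nat.mul_le_mul_left B h2
    have h4 := Nat.lt_mul_div_succ j hB
    -- `c` is the delay that reaches the start of the interval of departure. Memorylessness at `c`
    -- makes the normalization of the position law cancel.
    obtain ⟨c, hc⟩ : ∃ c, B * ((j + e) / B) = j + c := ⟨B * ((j + e) / B) - j, by omega⟩
    have h5 : {d | (j + d) / B = (j + e) / B} = Set.Ico c (c + B) := by
      ext d
      simp only [Set.mem_ofPred_eq, Set.mem_Ico]
      rw [Nat.div_eq_iff hB, mul_comm, hc]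
      omega
    have h6 : Set.Iio B ∩ {r | r % B = (j + e) % B} = {(j + e) % B} := by
      ext r
      simp only [Set.mem_inter_iff, Set.mem_Iio, Set.mem_ofPred_eq, Set.mem_singleton_iff]
      constructor
      · rintro ⟨h, h'⟩; rwa [Nat.mod_eq_of_lt h] at h'
      · rintro rfl; exact ⟨Nat.mod_lt _ hB, Nat.mod_mod _ _⟩
    have h7 : e = c + (j + e) % B := by
      have := Nat.div_add_mod (j + e) B
      omega
    rw [h1, Measure.prod_prod, h5, geometric_Ico hp, positionLaw, cond_apply measurableSet_Iio, h6]
    conv_rhs => rw [h7, geometric_add hp]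
    rw [mul_assoc, ← mul_assoc (geometricMeasure p (Set.Iio B)),
      ENNReal.mul_inv_cancel (geometric_Iio_ne_zero hp hB) (measure_ne_top _ _), one_mul]

instance (M : ℕ+) (n : ℕ) : IsProbabilityMeasure (delayLaw M n) := by
  unfold delayLaw; infer_instance

lemma departProb_ne_zero (M : ℕ+) : departProb M ≠ 0 := by
  intro h
  have h1 : (1 / ((M : ℕ) : ℝ)) = 0 := congrArg Subtype.val h
  have h2 : (0 : ℝ) < (M : ℕ) := by exact_mod_cast M.pos
  exact absurd h1 (by positivity)

lemma delayLaw_map_relocate (M : ℕ+) (n : ℕ) {B : ℕ} (hB : 0 < B) :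
    ((delayLaw M n).prod (Measure.pi fun _ : Fin n => positionLaw (departProb M) B)).map
      (fun z (j : Fin n) => relocate B j (z.1 j) (z.2 j)) = delayLaw M n := by
  have hp := departProb_ne_zero M
  have := isProbabilityMeasure_positionLaw hp hB
  have h1 := measurePreserving_arrowProdEquivProdArrow ℕ ℕ (Fin n)
    (fun _ => geometricMeasure (departProb M)) (fun _ => positionLaw (departProb M) B)
  rw [delayLaw, ← h1.map_eq, Measure.map_map Measurable.of_discrete h1.measurable]
  have h2 := Measure.pi_map_pi (ι := Fin n)
    (μ := fun _ => (geometricMeasure (departProb M)).prod (positionLaw (departProb M) B))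
    (f := fun (j : Fin n) z => relocate B j z.1 z.2)
    (hμ := fun j => by rw [map_relocate hp hB]; infer_instance)
    fun _ => Measurable.of_discrete.aemeasurable
  simp only [map_relocate hp hB] at h2
  exact h2

/-! ### Occupation profiles -/

/-- The numbers of departures when the symbol `j` leaves at the position `r j` of the interval with
index `a j`. -/
def departures {n : ℕ} (B : ℕ) (a r : Fin n → ℕ) : Counts n := fun i =>
  (Finset.univ.filter fun j => B * a j + r j % B = i).card

/-- The intervals `a j` at which the symbols leave have the given occupation numbers for the first
`m` intervals; the index `m` stands for symbols that are not received. -/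
def HasProfile {n m : ℕ} (a : Fin n → ℕ) (c : Fin m → ℕ) : Prop :=
  (∀ j, a j ≤ m) ∧ ∀ t : Fin m, (Finset.univ.filter fun j => a j = t).card = c t

lemma HasProfile.card_eq {n m : ℕ} {a a' : Fin n → ℕ} {c : Fin m → ℕ} (h : HasProfile a c)
    (h' : HasProfile a' c) (t : ℕ) : (Finset.univ.filter fun j => a j = t).card =
      (Finset.univ.filter fun j => a' j = t).card := by
  have hlt : ∀ t < m, (Finset.univ.filter fun j => a j = t).card =
      (Finset.univ.filter fun j => a' j = t).card := fun t ht =>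
    (h.2 ⟨t, ht⟩).trans (h'.2 ⟨t, ht⟩).symm
  rcases lt_trichotomy t m with ht | rfl | ht
  · exact hlt t ht
  · have e : ∀ b : Fin n → ℕ, (∀ j, b j ≤ t) →
        n = ∑ s ∈ Finset.range t, (Finset.univ.filter fun j => b j = s).card +
          (Finset.univ.filter fun j => b j = t).card := by
      intro b hb
      rw [← Finset.sum_range_succ (fun s => (Finset.univ.filter fun j => b j = s).card),
        ← Finset.card_eq_sum_card_fiberwise (s := Finset.univ)]
      · simp
      · intro j _; simpa [Nat.lt_succ_iff] using hb j
    have e1 := e a h.1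
    have e2 := e a' h'.1
    rw [Finset.sum_congr rfl fun s hs => hlt s (Finset.mem_range.1 hs)] at e1
    omega
  · have e : ∀ b : Fin n → ℕ, (∀ j, b j ≤ m) →
        (Finset.univ.filter fun j => b j = t) = ∅ := fun b hb =>
      Finset.filter_eq_empty_iff.2 fun j _ hj => by have := hb j; omega
    rw [e a h.1, e a' h'.1]

/-- The law of the departures depends on the occupation numbers only. -/
lemma HasProfile.map_departures_eq {n m B : ℕ} {a a' : Fin n → ℕ} {c : Fin m → ℕ}
    (h : HasProfile a c) (h' : HasProfile a' c) (ν : Measure ℕ) [IsProbabilityMeasure ν] :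
    (Measure.pi fun _ : Fin n => ν).map (departures B a) =
      (Measure.pi fun _ : Fin n => ν).map (departures B a') := by
  have e : ∀ t, Nonempty ({j // a j = t} ≃ {j // a' j = t}) := fun t => by
    refine ⟨Fintype.equivOfCardEq ?_⟩
    rw [Fintype.card_subtype, Fintype.card_subtype]
    exact h.card_eq h' t
  -- Equal occupation numbers give a permutation of the symbols that carries `a` to `a'`, and
  -- independent identically distributed positions are invariant under it.
  let σ : Fin n ≃ Fin n := Equiv.ofFiberEquiv fun t => (e t).some
  have hσ : ∀ j, a' (σ j) = a j := Equiv.ofFiberEquiv_map _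
  have h1 := measurePreserving_piCongrLeft (fun _ : Fin n => ν) σ
  have h2 : departures B a = fun r => departures B a'
      (MeasurableEquiv.piCongrLeft (fun _ : Fin n => ℕ) σ r) := by
    ext r i
    simp only [departures]
    refine Finset.card_bij (fun j _ => σ j) ?_ (fun x _ y _ hxy => σ.injective hxy) ?_
    · intro j hj
      simp only [Finset.mem_filter, Finset.mem_univ, true_and] at hj ⊢
      rw [hσ, MeasurableEquiv.piCongrLeft_apply_apply]
      exact hj
    · intro j hj
      refine ⟨σ.symm j, ?_, by simp⟩
      obtain ⟨k, rfl⟩ := σ.surjective j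
      simp only [Finset.mem_filter, Finset.mem_univ, true_and] at hj ⊢
      rw [hσ, MeasurableEquiv.piCongrLeft_apply_apply] at hj
      simpa using hj
  conv_rhs => rw [← h1.map_eq]
  rw [Measure.map_map Measurable.of_discrete h1.measurable, h2]
  rfl

/-- Give `s` the weight `∏ 2 ^ (-s t)`. Each counted `s` weighs at least `2 ^ (-N)`, while the total
weight is at most the `m`-th power of a geometric sum bounded by 2. -/
lemma card_filter_sum_le (m N : ℕ) :
    (Finset.univ.filter fun s : Fin m → Fin (N + 1) => ∑ t, (s t : ℕ) ≤ N).card ≤ 2 ^ (m + N) := by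
  have h1 : ((Finset.univ.filter fun s : Fin m → Fin (N + 1) => ∑ t, (s t : ℕ) ≤ N).card : ℝ) *
      (1 / 2) ^ N ≤ 2 ^ m := by
    calc _ = ∑ _s ∈ Finset.univ.filter fun s : Fin m → Fin (N + 1) => ∑ t, (s t : ℕ) ≤ N,
          (1 / 2 : ℝ) ^ N := by simp
      _ ≤ ∑ s ∈ Finset.univ.filter fun s : Fin m → Fin (N + 1) => ∑ t, (s t : ℕ) ≤ N,
          ∏ t, (1 / 2 : ℝ) ^ (s t : ℕ) := by
        refine Finset.sum_le_sum fun s hs => ?_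
        rw [Finset.prod_pow_eq_pow_sum]
        exact pow_le_pow_of_le_one (by norm_num) (by norm_num) (Finset.mem_filter.1 hs).2
      _ ≤ ∑ s : Fin m → Fin (N + 1), ∏ t, (1 / 2 : ℝ) ^ (s t : ℕ) :=
        Finset.sum_le_sum_of_subset_of_nonneg (Finset.filter_subset _ _)
          fun _ _ _ => Finset.prod_nonneg fun _ _ => by positivity
      _ = ∏ _t : Fin m, ∑ v : Fin (N + 1), (1 / 2 : ℝ) ^ (v : ℕ) := by
        rw [Finset.prod_univ_sum, Fintype.piFinset_univ]
      _ ≤ ∏ _t : Fin m, 2 := by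
        refine Finset.prod_le_prod (fun _ _ => Finset.sum_nonneg fun _ _ => by positivity)
          fun t _ => ?_
        rw [Fin.sum_univ_eq_sum_range fun v => (1 / 2 : ℝ) ^ v]
        exact (summable_geometric_two.sum_le_tsum _ fun _ _ => by positivity).trans
          tsum_geometric_two.le
      _ = 2 ^ m := by simp
  have h2 : ((Finset.univ.filter fun s : Fin m → Fin (N + 1) => ∑ t, (s t : ℕ) ≤ N).card : ℝ) ≤
      2 ^ (m + N) := by
    rw [one_div, inv_pow, mul_inv_le_iff₀ (by positivity)] at h1
    rw [pow_add]; exact h1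
  exact_mod_cast h2

/-- The sum of the laws of the departures for all occupation numbers that are multiples of `q`. -/
def profileMeasure (ν : Measure ℕ) (B q n m : ℕ) : Measure (Counts n) :=
  open Classical in
  ∑ s ∈ Finset.univ.filter fun s : Fin m → Fin (n / q + 1) => ∑ t, (s t : ℕ) ≤ n / q,
    -- Any assignment with this profile gives the same law, so an arbitrary choice serves;
    -- unrealizable profiles contribute nothing.
    if h : ∃ a : Fin n → ℕ, HasProfile a (fun t => q * (s t : ℕ)) then
      (Measure.pi fun _ : Fin n => ν).map (departures B h.choose) else 0

lemma profileMeasure_univ_le (ν : Measure ℕ) [IsProbabilityMeasure ν] (B q n m : ℕ) :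
    profileMeasure ν B q n m Set.univ ≤ 2 ^ (m + n / q) := by
  classical
  simp only [profileMeasure, Measure.coe_finsetSum, Finset.sum_apply]
  refine (Finset.sum_le_card_nsmul _ _ 1 fun s _ => ?_).trans ?_
  · split_ifs
    · have := Measure.isProbabilityMeasure_map (μ := Measure.pi fun _ : Fin n => ν)
        (f := departures B (Exists.choose ‹_›)) Measurable.of_discrete.aemeasurable
      exact prob_le_one
    · simp
  · rw [nsmul_eq_mul, mul_one]
    exact_mod_cast card_filter_sum_le m (n / q)

lemma map_departures_le_profileMeasure (ν : Measure ℕ) [IsProbabilityMeasure ν] {B q n m : ℕ}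
    (hq : 0 < q) {a : Fin n → ℕ} (ha : ∀ j, a j ≤ m)
    (hd : ∀ t < m, q ∣ (Finset.univ.filter fun j => a j = t).card) (S : Set (Counts n)) :
    (Measure.pi fun _ : Fin n => ν).map (departures B a) S ≤ profileMeasure ν B q n m S := by
  classical
  set f : Fin m → ℕ := fun t => (Finset.univ.filter fun j => a j = t).card / q with hf
  have hfq : ∀ t, q * f t = (Finset.univ.filter fun j => a j = t).card := fun t =>
    Nat.mul_div_cancel' (hd t t.2)
  have hsum : ∑ t, f t ≤ n / q := by
    rw [Nat.le_div_iff_mul_le hq, mul_comm, Finset.mul_sum]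
    simp_rw [hfq]
    calc _ = ((Finset.univ : Finset (Fin m)).biUnion fun t =>
          Finset.univ.filter fun j : Fin n => a j = t).card := by
          rw [Finset.card_biUnion]
          intro t _ t' _ htt
          refine Finset.disjoint_left.2 fun j hj hj' => htt (Fin.ext ?_)
          exact (Finset.mem_filter.1 hj).2.symm.trans (Finset.mem_filter.1 hj').2
      _ ≤ n := by simpa using Finset.card_le_univ (α := Fin n) _
  have hlt : ∀ t, f t < n / q + 1 := fun t =>
    Nat.lt_succ_of_le ((Finset.single_le_sum (f := f) (by simp) (Finset.mem_univ t)).trans hsum)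
  have hprof : HasProfile a (fun t => q * ((⟨f t, hlt t⟩ : Fin (n / q + 1)) : ℕ)) :=
    ⟨ha, fun t => (hfq t).symm⟩
  have hex : ∃ a : Fin n → ℕ, HasProfile a (fun t => q * ((⟨f t, hlt t⟩ : Fin (n / q + 1)) : ℕ)) :=
    ⟨a, hprof⟩
  simp only [profileMeasure, Measure.coe_finsetSum, Finset.sum_apply]
  refine le_trans ?_ (Finset.single_le_sum (f := fun s : Fin m → Fin (n / q + 1) =>
    (if h : ∃ a : Fin n → ℕ, HasProfile a (fun t => q * (s t : ℕ)) then
      (Measure.pi fun _ : Fin n => ν).map (departures B h.choose) else 0) S) (by simp)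
    (a := fun t => ⟨f t, hlt t⟩) (by simpa using hsum))
  simp only
  rw [dif_pos hex, hprof.map_departures_eq hex.choose_spec]

/-! ### Short delays and the thinning noise -/

lemma geometric_Iio_le (M : ℕ+) (B : ℕ) :
    geometricMeasure (departProb M) (Set.Iio B) ≤ ENNReal.ofReal (B / (M : ℕ)) := by
  have h : Set.Iio B = Set.Ico 0 (0 + B) := by ext; simp
  rw [h, measure_Ico_eq_sum]
  calc _ ≤ ∑ _r ∈ Finset.range B, ENNReal.ofReal (1 / (M : ℕ)) := by
        refine Finset.sum_le_sum fun r _ => ?_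
        rw [geometricMeasure_singleton (departProb_ne_zero M)]
        refine ENNReal.ofReal_le_ofReal ?_
        have h1 : ((1 : ℝ) - departProb M) ^ (0 + r) ≤ 1 :=
          pow_le_one₀ (by linarith [(departProb M).2.2]) (by linarith [(departProb M).2.1])
        exact mul_le_of_le_one_left (departProb M).2.1 h1
    _ = _ := by
        rw [← ENNReal.ofReal_sum_of_nonneg fun _ _ => by positivity]
        congr 1
        simp [div_eq_mul_inv]

/-- Few symbols have a short delay. -/
lemma delayLaw_many_short_le (M : ℕ+) (n B : ℕ) {c : ℝ} (hc : 0 < c) (h : 4 * (n * B) ≤ c * (M : ℕ)) :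
    delayLaw M n {Δ | c ≤ ((Finset.univ.filter fun j => Δ j < B).card : ℝ)} ≤ 1 / 4 := by
  classical
  have hM : (0 : ℝ) < (M : ℕ) := by exact_mod_cast M.pos
  have hint : ∫⁻ Δ, ((Finset.univ.filter fun j => Δ j < B).card : ℝ≥0∞) ∂(delayLaw M n) ≤
      ENNReal.ofReal (n * (B / (M : ℕ))) := by
    have h1 : ∀ Δ : Counts n, ((Finset.univ.filter fun j => Δ j < B).card : ℝ≥0∞) =
        ∑ j, (Set.Iio B).indicator 1 (Δ j) := by
      intro Δ
      rw [Finset.card_filter]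
      push_cast
      refine Finset.sum_congr rfl fun j _ => ?_
      by_cases hj : Δ j < B <;> simp [hj]
    simp_rw [h1]
    rw [lintegral_finsetSum _ fun _ _ => Measurable.of_discrete]
    calc _ = ∑ _j : Fin n, geometricMeasure (departProb M) (Set.Iio B) := by
          refine Finset.sum_congr rfl fun j _ => ?_
          have h2 := measurePreserving_eval (fun _ : Fin n => geometricMeasure (departProb M)) j
          rw [delayLaw, h2.lintegral_comp (f := (Set.Iio B).indicator 1) Measurable.of_discrete,
            lintegral_indicator_one measurableSet_Iio]
      _ ≤ ∑ _j : Fin n, ENNReal.ofReal (B / (M : ℕ)) :=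
          Finset.sum_le_sum fun _ _ => geometric_Iio_le M B
      _ = _ := by
          rw [Finset.sum_const, Finset.card_univ, Fintype.card_fin, nsmul_eq_mul,
            ENNReal.ofReal_mul (Nat.cast_nonneg _), ENNReal.ofReal_natCast]
  have hsub : {Δ : Counts n | c ≤ ((Finset.univ.filter fun j => Δ j < B).card : ℝ)} ⊆
      {Δ | ENNReal.ofReal c ≤ ((Finset.univ.filter fun j => Δ j < B).card : ℝ≥0∞)} := by
    intro Δ hΔ
    have := ENNReal.ofReal_le_ofReal (show c ≤ _ from hΔ)
    rwa [ENNReal.ofReal_natCast] at this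
  calc _ ≤ _ := measure_mono hsub
    _ ≤ (∫⁻ Δ, ((Finset.univ.filter fun j => Δ j < B).card : ℝ≥0∞) ∂(delayLaw M n)) /
        ENNReal.ofReal c :=
        meas_ge_le_lintegral_div Measurable.of_discrete.aemeasurable
          (ENNReal.ofReal_pos.2 hc).ne' ENNReal.ofReal_ne_top
    _ ≤ ENNReal.ofReal (n * (B / (M : ℕ))) / ENNReal.ofReal c := by gcongr
    _ = ENNReal.ofReal (n * (B / (M : ℕ)) / c) := (ENNReal.ofReal_div_of_pos hc).symm
    _ ≤ ENNReal.ofReal (1 / 4) := by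
        refine ENNReal.ofReal_le_ofReal ?_
        rw [← mul_div_assoc, div_div, div_le_div_iff₀ (by positivity) (by norm_num)]
        linarith
    _ = 1 / 4 := by
        rw [ENNReal.ofReal_div_of_pos (by norm_num)]; simp

/-- The interval in which each symbol leaves. -/
def exitIndex {n : ℕ} (B : ℕ) (Δ : Counts n) : Fin n → ℕ := fun j => (j + Δ j) / B

/-- The ones that leave in one of the first `m` intervals, but not in the one they were sent in. -/
def movingOnes {n : ℕ} (B m : ℕ) (X : Word n) (l : Fin n → ℕ) : Finset (Fin n) :=
  Finset.univ.filter fun j => X j = true ∧ l j ≠ j / B ∧ l j < m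

/-- The noise that lets only the ones in `A`, and those leaving late, survive. -/
def thinningNoise {n : ℕ} (m : ℕ) (A : Word n → (Fin n → ℕ) → Finset (Fin n)) (X : Word n)
    (l : Fin n → ℕ) : Word n :=
  killNoise X (A X l ∪ Finset.univ.filter fun j => X j = true ∧ m ≤ l j)

section Thinning

variable {n B m q : ℕ} {A : Word n → (Fin n → ℕ) → Finset (Fin n)}

/-- A one leaving in its own interval has delay less than `B`; every other erased one is lost to
rounding, at most `q - 1` in each of the `m` intervals. Ones with exit index at least `m` are
spared, which saves budget. -/
lemma flips_thinningNoise_le (hB : 0 < B) (hq : 0 < q)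
    (hAsub : ∀ X l, A X l ⊆ movingOnes B m X l)
    (hAcard : ∀ X l t, ((A X l).filter (l · = t)).card =
      q * (((movingOnes B m X l).filter (l · = t)).card / q)) (X : Word n) (Δ : Counts n) :
    flips (thinningNoise m A X (exitIndex B Δ)) ≤
      (Finset.univ.filter fun j => Δ j < B).card + m * (q - 1) := by
  classical
  set l := exitIndex B Δ with hl
  rw [thinningNoise, flips_killNoise]
  have hround : (movingOnes B m X l \ A X l).card ≤ m * (q - 1) := by
    have hmaps : ∀ j ∈ movingOnes B m X l \ A X l, l j ∈ Finset.range m := fun j hj =>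
      Finset.mem_range.2 (Finset.mem_filter.1 (Finset.mem_sdiff.1 hj).1).2.2.2
    rw [Finset.card_eq_sum_card_fiberwise hmaps]
    calc _ ≤ ∑ _t ∈ Finset.range m, (q - 1) := Finset.sum_le_sum fun t _ =>
          card_sdiff_filter_le hq (hAsub X l) (hAcard X l t)
      _ = m * (q - 1) := by simp
  refine le_trans (Finset.card_le_card ?_) ((Finset.card_union_le _ _).trans
    (Nat.add_le_add_left hround _))
  intro j hj
  simp only [Finset.mem_sdiff, Finset.mem_union, Finset.mem_filter, Finset.mem_univ, true_and,
    not_or, not_and, not_le, movingOnes] at hj ⊢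
  obtain ⟨h1, h2, h3⟩ := hj
  by_cases h4 : l j = j / B
  · left
    have h5 := Nat.lt_mul_div_succ ((j : ℕ) + Δ j) hB
    have h6 := Nat.mul_div_le (j : ℕ) B
    have h7 : ((j : ℕ) + Δ j) / B = j / B := h4
    rw [h7, mul_add] at h5
    omega
  · exact Or.inr ⟨⟨h1, h4, h3 h1⟩, h2⟩

lemma exitIndex_relocate (hB : 0 < B) (Δ r : Counts n) :
    exitIndex B (fun j => relocate B j (Δ j) (r j)) = exitIndex B Δ := by
  ext j; exact add_relocate_div hB _

/-- The noise sees the delays only through the exit indices, which relocation preserves, so it stays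
fixed while positions are resampled. Index `m` stands for an instant of at least `B * m ≥ n`, which
is not received. -/
lemma received_relocate (hB : 0 < B) (hn : n ≤ B * m)
    (hAsub : ∀ X l, A X l ⊆ movingOnes B m X l) (X : Word n) (Δ r : Counts n) :
    received X (thinningNoise m A X (exitIndex B Δ)) (fun j => relocate B j (Δ j) (r j)) =
      departures B (fun j => if j ∈ A X (exitIndex B Δ) then exitIndex B Δ j else m) r := by
  classical
  set l := exitIndex B Δ with hl
  have hdiv : ∀ j : Fin n, ((j : ℕ) + relocate B j (Δ j) (r j)) / B = l j := fun j =>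
    add_relocate_div hB _
  have hA : ∀ j ∈ A X l, X j = true ∧ l j ≠ j / B ∧ l j < m := fun j hj => by
    simpa [movingOnes] using hAsub X l hj
  ext i
  rw [thinningNoise, received_killNoise]
  swap
  · intro j hj
    rcases Finset.mem_union.1 hj with h | h
    · exact (hA j h).1
    · exact (Finset.mem_filter.1 h).2.1
  rw [departures]
  congr 1
  ext j
  simp only [Finset.mem_filter, Finset.mem_union, Finset.mem_univ, true_and]
  have hlate : m ≤ l j → (j : ℕ) + relocate B j (Δ j) (r j) ≠ i := by
    intro h1 h2
    have h3 := hdiv j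
    rw [h2] at h3
    have h4 : (i : ℕ) / B < m := Nat.div_lt_of_lt_mul (i.2.trans_le hn)
    omega
  by_cases hj : j ∈ A X l
  · have h1 : (j : ℕ) + relocate B j (Δ j) (r j) = B * l j + r j % B :=
      add_relocate hB _ (hA j hj).2.1
    simp [hj, h1]
  · have h1 : B * m + r j % B ≠ i := by have := i.2; omega
    simp only [hj, false_or, if_false, h1, iff_false, not_and]
    exact fun h => hlate h.2

/-- After resampling, the original delays are held fixed: the output then has the law of one profile
of multiples of `q`, which `profileMeasure` dominates. Integration over the delays keeps the bound.
-/
lemma delayLaw_map_received_le (M : ℕ+) (hB : 0 < B) (hn : n ≤ B * m) (hq : 0 < q)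
    (hAsub : ∀ X l, A X l ⊆ movingOnes B m X l)
    (hAcard : ∀ X l t, ((A X l).filter (l · = t)).card =
      q * (((movingOnes B m X l).filter (l · = t)).card / q)) (X : Word n) (S : Set (Counts n)) :
    delayLaw M n {Δ | received X (thinningNoise m A X (exitIndex B Δ)) Δ ∈ S} ≤
      profileMeasure (positionLaw (departProb M) B) B q n m S := by
  classical
  have := isProbabilityMeasure_positionLaw (departProb_ne_zero M) hB
  conv_lhs => rw [← delayLaw_map_relocate M n hB]
  rw [Measure.map_apply Measurable.of_discrete MeasurableSet.of_discrete,
    Measure.prod_apply MeasurableSet.of_discrete]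
  calc _ ≤ ∫⁻ _Δ, profileMeasure (positionLaw (departProb M) B) B q n m S ∂(delayLaw M n) := by
        refine lintegral_mono fun Δ => ?_
        set a : Fin n → ℕ := fun j => if j ∈ A X (exitIndex B Δ) then exitIndex B Δ j else m with ha
        have hA : ∀ j ∈ A X (exitIndex B Δ), exitIndex B Δ j < m := fun j hj =>
          (Finset.mem_filter.1 (hAsub X _ hj)).2.2.2
        refine le_trans (le_of_eq ?_) (map_departures_le_profileMeasure
          (positionLaw (departProb M) B) (a := a) hq (fun j => ?_) (fun t ht => ?_) S)
        · rw [Measure.map_apply Measurable.of_discrete MeasurableSet.of_discrete]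
          congr 1
          ext r
          simp only [Set.mem_preimage, Set.mem_ofPred_eq]
          rw [exitIndex_relocate hB, received_relocate hB hn hAsub]
        · simp only [ha]
          split_ifs with hj
          · exact (hA j hj).le
          · exact le_rfl
        · have : (Finset.univ.filter fun j => a j = t) =
              (A X (exitIndex B Δ)).filter (exitIndex B Δ · = t) := by
            ext j
            simp only [Finset.mem_filter, Finset.mem_univ, true_and, ha]
            by_cases hj : j ∈ A X (exitIndex B Δ)
            · simp [hj]
            · simp [hj, ht.ne']
          rw [this, hAcard]
          exact dvd_mul_right _ _
    _ = _ := by simp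

end Thinning

/-! ### Random delay and adversarial noise -/

theorem finiteCapacity_randDelayAdvNoise {ε : ℝ} (hε : 0 < ε) :
    FiniteCapacity (randDelayAdvNoise ε) := by
  classical
  -- With `B = M / a` the expected number of delays below `B` is at most `ε n / 8`, so by Markov's
  -- inequality it reaches half of the budget, `ε n / 2`, with probability at most 1/4.
  set a := ⌈8 / ε⌉₊ with ha
  have ha0 : 0 < a := Nat.ceil_pos.2 (by positivity)
  have haε : 8 ≤ a * ε := by
    have := Nat.le_ceil (8 / ε)
    rwa [div_le_iff₀ hε] at this
  refine FiniteCapacity.of_dominated (fun M n => ?_) ?_ (4 * a + ⌈8 * a / ε⌉₊) a ?_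
  · refine ⟨fun X => _, fun _ _ _ => false, fun X Δ => ?_, fun X => rfl⟩
    simp only [flips]; simp; positivity
  · rintro M n W ⟨ν, -, h⟩ X
    rw [h]; exact Measure.isProbabilityMeasure_map Measurable.of_discrete.aemeasurable
  intro M T hT hM
  set n := (M : ℕ) * T with hn
  set B := (M : ℕ) / a with hBdef
  have hB : 0 < B := Nat.div_pos hM ha0
  have haB : a * B ≤ M := Nat.mul_div_le _ _
  have hMB : (M : ℕ) ≤ 2 * (a * B) := by
    have := Nat.lt_mul_div_succ (M : ℕ) ha0
    rw [mul_add, ← hBdef] at this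
    have : a ≤ a * B := Nat.le_mul_of_pos_right _ hB
    omega
  have hMn : (M : ℕ) ≤ n := Nat.le_mul_of_pos_right _ hT
  have hBn : B ≤ n := (Nat.div_le_self _ _).trans hMn
  set m := n / B + 1 with hm
  have hnm : n ≤ B * m := (Nat.lt_mul_div_succ n hB).le
  have hmB : m * B ≤ 2 * n := by
    have := Nat.div_mul_le_self n B
    rw [hm, add_mul]; omega
  -- As `m * B ≤ 2 * n`, rounding costs at most `m * (q - 1) ≤ ε n / 2`, the other half of the
  -- budget.
  set q := ⌊ε * B / 4⌋₊ + 1 with hq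
  have hq0 : 0 < q := Nat.succ_pos _
  have hBr : (0 : ℝ) < B := by exact_mod_cast hB
  have hnr : (0 : ℝ) < n := by exact_mod_cast hB.trans_le hBn
  have hq1 : ε * B / 4 ≤ q := by rw [hq]; push_cast; exact (Nat.lt_floor_add_one _).le
  have hq2 : ((q - 1 : ℕ) : ℝ) ≤ ε * B / 4 := by
    rw [hq, Nat.add_sub_cancel]; exact Nat.floor_le (by positivity)
  have hA := fun (X : Word n) (l : Fin n → ℕ) => exists_subset_fiber_card (movingOnes B m X l) l q
  choose A hAsub hAcard using hA
  let good : Word n → Counts n → Prop := fun X Δ =>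
    (flips (thinningNoise m A X (exitIndex B Δ)) : ℝ) ≤ ε * n
  have hbad : ∀ X, delayLaw M n {Δ | ¬ good X Δ} ≤ 1 / 4 := by
    intro X
    refine (measure_mono fun Δ hΔ => ?_).trans
      (delayLaw_many_short_le M n B (c := ε * n / 2) (by positivity) ?_)
    · have h1 := flips_thinningNoise_le hB hq0 hAsub hAcard X Δ
      have h2 : (flips (thinningNoise m A X (exitIndex B Δ)) : ℝ) ≤
          (Finset.univ.filter fun j => Δ j < B).card + m * ((q - 1 : ℕ) : ℝ) := by exact_mod_cast h1
      have h3 : (m : ℝ) * ((q - 1 : ℕ) : ℝ) ≤ ε * n / 2 := by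
        have h4 : (m : ℝ) * B ≤ 2 * n := by exact_mod_cast hmB
        calc (m : ℝ) * ((q - 1 : ℕ) : ℝ) ≤ m * (ε * B / 4) := by gcongr
          _ = ε / 4 * (m * B) := by ring
          _ ≤ ε / 4 * (2 * n) := by gcongr
          _ = ε * n / 2 := by ring
      have h5 : ε * n < flips (thinningNoise m A X (exitIndex B Δ)) := not_le.1 hΔ
      change ε * n / 2 ≤ _
      linarith
    · have h1 : (a : ℝ) * B ≤ (M : ℕ) := by exact_mod_cast haB
      have h2 : 8 * (B : ℝ) ≤ ε * (M : ℕ) := by nlinarith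
      nlinarith
  -- The noise bound must hold for every delay, so nothing is flipped when thinning would be too
  -- expensive; that event is absorbed by the slack 1/4.
  refine ⟨_, ⟨fun X Δ => if good X Δ then thinningNoise m A X (exitIndex B Δ) else fun _ => false,
    fun X Δ => ?_, fun X => rfl⟩, profileMeasure (positionLaw (departProb M) B) B q n m, ?_,
    fun X S => ?_⟩
  · beta_reduce
    split_ifs with h
    · exact h
    · simp only [flips]; simp; positivity
  · have := isProbabilityMeasure_positionLaw (departProb_ne_zero M) hB
    refine (profileMeasure_univ_le _ B q n m).trans (pow_le_pow_right₀ (by norm_num) ?_)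
    have hm' : m ≤ 4 * a * T := by
      refine Nat.le_of_mul_le_mul_right (c := B) ?_ hB
      calc m * B ≤ 2 * n := hmB
        _ = 2 * (M * T) := rfl
        _ ≤ 2 * (2 * (a * B) * T) := by gcongr
        _ = 4 * a * T * B := by ring
    have hN : n / q ≤ ⌈8 * a / ε⌉₊ * T := by
      have h1 : ((n / q : ℕ) : ℝ) * (ε * B / 4) ≤ 2 * (a * B) * T := by
        calc ((n / q : ℕ) : ℝ) * (ε * B / 4) ≤ ((n / q : ℕ) : ℝ) * q := by gcongr
          _ ≤ n := by exact_mod_cast Nat.div_mul_le_self n q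
          _ ≤ 2 * (a * B) * T := by exact_mod_cast Nat.mul_le_mul_right T hMB
      have h2 : ((n / q : ℕ) : ℝ) ≤ 8 * a / ε * T := by
        rw [div_mul_eq_mul_div, le_div_iff₀ hε]
        refine le_of_mul_le_mul_right ?_ hBr
        nlinarith
      have h3 : (8 * a / ε * T : ℝ) ≤ (⌈8 * a / ε⌉₊ * T : ℕ) := by
        push_cast; gcongr; exact Nat.le_ceil _
      exact_mod_cast h2.trans h3
    calc m + n / q ≤ 4 * a * T + ⌈8 * a / ε⌉₊ * T := Nat.add_le_add hm' hN
      _ = _ := by ring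
  · rw [Measure.map_apply Measurable.of_discrete MeasurableSet.of_discrete]
    refine (measure_mono (t := {Δ | received X (thinningNoise m A X (exitIndex B Δ)) Δ ∈ S} ∪
      {Δ | ¬ good X Δ}) fun Δ hΔ => ?_).trans ((measure_union_le _ _).trans
        (add_le_add (delayLaw_map_received_le M hB hnm hq0 hAsub hAcard X S) (hbad X)))
    by_cases hg : good X Δ
    · left
      simpa [hg] using hΔ
    · exact Or.inr hg

end DelayChannel

end

theorem theorem1 :
    (∀ ε : ℝ, 0 < ε →
      DelayChannel.FiniteCapacity (DelayChannel.advDelayAdvNoise ε) ∧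
      DelayChannel.FiniteCapacity (DelayChannel.randDelayAdvNoise ε)) ∧
    (∀ ε : unitInterval, 0 < ε → ε < 1 →
      DelayChannel.FiniteCapacity (DelayChannel.advDelayRandNoise ε) ∧
      DelayChannel.FiniteCapacity (DelayChannel.randNoiseAdvDelay ε)) := by
  exact ⟨fun ε hε => ⟨DelayChannel.finiteCapacity_advDelayAdvNoise hε,
    DelayChannel.finiteCapacity_randDelayAdvNoise hε⟩,
    fun ε h0 h1 => ⟨DelayChannel.finiteCapacity_advDelayRandNoise h0 h1,
      DelayChannel.finiteCapacity_randNoiseAdvDelay h0 h1⟩⟩
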